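/- Let $\mu$ be a symmetric probability measure on $\mathbb R$ with unit variance. Put $L(x)=\log\int e^{xt}\,d\mu(t)$ and $\psi(x)=L(x)/x^2$ for $x\neq 0$, $\psi(0)=1/2$. Assume that $L$ is finite, that $A/2:=\sup_{x\in\mathbb R}\psi(x)<\infty$, that the limit $B/2:=\lim_{|x|\to\infty}\psi(x)$ exists, that $u\mapsto L(\sqrt u)$ is Lipschitz on $[0,\infty)$, and that $A>1$. For each $N\ge 1$ let $X_N$ be an $N\times N$ real symmetric random matrix with independent entries $(X_{ij})_{i\le j}$ such that $\sqrt N X_{ij}$ has law $\mu$ for $i<j$ and $\sqrt{N/2}\,X_{ii}$ has law $\mu$ for all $i$. With $e$ uniformly distributed on the unit sphere $\mathbb S^{N-1}$ of $\mathbb R^N$, independent of $X_N$, let $$F_N(\theta)=\frac1N\log\mathbb E_{X_N}\mathbb E_e\big[e^{N\theta\langle e,X_Ne\rangle}\big],\qquad \overline F(\theta)=\limsup_{N\to\infty}F_N(\theta),\qquad \theta\ge 0.$$ Let $\sigma(dx)=\frac1{2\pi}\sqrt{4-x^2}\,\mathbf 1_{|x|\le 2}\,dx$ be the semicircle law, $G(x)=\int\frac{1}{x-t}\,d\sigma(t)$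 for $x>2$ its Stieltjes transform, $G(2)=\lim_{t\downarrow 2}G(t)$, let $K$ be the inverse of the decreasing function $G$ on $[2,\infty)$, and $R(z)=K(z)-1/z$. For $x\ge 2$ and $\theta\ge 0$ let $$J(x,\theta)=\theta v-\frac12\int\log(1+2\theta v-2\theta y)\,d\sigma(y),\qquad v=\begin{cases}R(2\theta)&\text{if }2\theta\le G(x),\\ x-\frac1{2\theta}&\text{if }2\theta>G(x),\end{cases}$$ with $J(x,0)=0$. Define $\bar I:\mathbb R\to[0,\infty]$ by $\bar I(x)=+\infty$ for $x<2$ and $$\bar I(x)=\sup_{\theta\ge 0}\{J(x,\theta)-\overline F(\theta)\}\qquad\text{for }x\ge 2.$$ Then $\bar I$ is lower semicontinuous, and $$\lim_{x\to+\infty}\frac{\bar I(x)}{x^2}=\frac1{4A}.$$ In particular $\bar I$ is a good rate function: it takes values in $[0,\infty]$, is lower semicontinuous, and its sublevel sets $\{x:\bar I(x)\le a\}$, $a\in\mathbb R$, are compact. -/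

import Mathlib

open MeasureTheory ProbabilityTheory Filter Topology

noncomputable section

namespace WignerLDP

/-! ### The entry distribution -/

/-- The log-Laplace transform `L(x) = log ∫ e^{xt} dμ(t)`. -/
def logLaplace (μ : Measure ℝ) (x : ℝ) : ℝ :=
  Real.log (∫ t, Real.exp (x * t) ∂μ)

/-- `ψ(x) = L(x) / x²`, extended by its limit `ψ(0) = 1/2` at the origin
(for a centered law with unit variance). -/
def psi (μ : Measure ℝ) (x : ℝ) : ℝ :=
  if x = 0 then 1 / 2 else logLaplace μ x / x ^ 2

/-- The standing assumption on the law `μ` of the entries: `μ` is symmetric with unit variance,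
sub-Gaussian with `sup ψ = A / 2 < ∞`, `ψ(x) → B / 2` as `|x| → ∞`, `u ↦ L(√u)` is Lipschitz on
`[0, ∞)`, and `μ` does not have sharp sub-Gaussian tails, i.e. `A > 1`.
Finiteness of `L` (part of `sup ψ < ∞`) is recorded as integrability of the exponentials. -/
structure SubGaussianEntries (μ : Measure ℝ) (A B : ℝ) : Prop where
  symm : μ.map (fun t => -t) = μ
  variance_eq_one : variance id μ = 1
  integrable_exp : ∀ x : ℝ, Integrable (fun t => Real.exp (x * t)) μ
  isLUB_psi : IsLUB (Set.range (psi μ)) (A / 2)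
  tendsto_psi : Tendsto (psi μ) (cocompact ℝ) (𝓝 (B / 2))
  lipschitz : ∃ C : NNReal, LipschitzOnWith C (fun u => logLaplace μ (Real.sqrt u)) (Set.Ici 0)
  one_lt : 1 < A

/-! ### Wigner matrices -/

/-- `X` is an `N × N` symmetric random matrix whose entries `X i j`, `i ≤ j`, are independent,
such that `√N X i j` has law `μ` for `i < j` and `√(N/2) X i i` has law `μ`. -/
structure IsWigner {Ω : Type*} [MeasurableSpace Ω] (μ : Measure ℝ) (P : Measure Ω) (N : ℕ)
    (X : Ω → Matrix (Fin N) (Fin N) ℝ) : Prop where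
  symm : ∀ ω, (X ω).IsSymm
  indep : iIndepFun
    (fun (p : {p : Fin N × Fin N // p.1 ≤ p.2}) ω => X ω p.1.1 p.1.2) P
  law_offDiag : ∀ i j, i < j → HasLaw (fun ω => Real.sqrt N * X ω i j) μ P
  law_diag : ∀ i, HasLaw (fun ω => Real.sqrt (N / 2) * X ω i i) μ P

/-! ### The annealed spherical integral -/

/-- The uniform probability measure on the unit sphere of `ℝ^N`: normalized surface measure. -/
def uniformSphere (N : ℕ) : Measure (Metric.sphere (0 : EuclideanSpace ℝ (Fin N)) 1) :=
  ((volume : Measure (EuclideanSpace ℝ (Fin N))).toSphere Set.univ)⁻¹ •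
    (volume : Measure (EuclideanSpace ℝ (Fin N))).toSphere

/-- The spherical integral `I_N(M, θ) = E_e[exp(θ N ⟨e, M e⟩)]`. -/
def sphericalIntegral {N : ℕ} (M : Matrix (Fin N) (Fin N) ℝ) (θ : ℝ) : ℝ :=
  ∫ e, Real.exp (θ * N * (e.1.ofLp ⬝ᵥ M.mulVec e.1.ofLp)) ∂(uniformSphere N)

/-- `F_N(θ) = (1/N) log E_X E_e[exp(N θ ⟨e, X e⟩)]`. -/
def annealed {Ω : Type*} [MeasurableSpace Ω] (P : Measure Ω) {N : ℕ}
    (X : Ω → Matrix (Fin N) (Fin N) ℝ) (θ : ℝ) : ℝ :=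
  (1 / (N : ℝ)) * Real.log (∫ ω, sphericalIntegral (X ω) θ ∂P)

/-- `F̄(θ) = limsup_N F_N(θ)`. -/
def annealedLimsup {Ω : ℕ → Type*} [∀ N, MeasurableSpace (Ω N)] (P : ∀ N, Measure (Ω N))
    (X : ∀ N, Ω N → Matrix (Fin N) (Fin N) ℝ) (θ : ℝ) : EReal :=
  limsup (fun N : ℕ => ((annealed (P N) (X N) θ : ℝ) : EReal)) atTop

/-! ### The limit of spherical integrals -/

/-- The right edge of the support of a measure on `ℝ`. -/
def rightEdge (ν : Measure ℝ) : ℝ := sSup ν.support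

/-- The Stieltjes transform `G_ν(z) = ∫ 1/(z - t) dν(t)`. -/
def stieltjes (ν : Measure ℝ) (z : ℝ) : ℝ := ∫ t, 1 / (z - t) ∂ν

/-- The Stieltjes transform on `[r_ν, ∞)`, where the value at the right edge `r_ν` is the
(possibly infinite) limit of `G_ν(t)` as `t ↓ r_ν`. -/
def stieltjesExt (ν : Measure ℝ) (x : ℝ) : EReal :=
  if x = rightEdge ν then limsup (fun t => (stieltjes ν t : EReal)) (𝓝[>] (rightEdge ν))
  else (stieltjes ν x : EReal)

/-- The inverse `K_ν` of the Stieltjes transform on `[r_ν, ∞)`. -/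
def stieltjesInv (ν : Measure ℝ) (z : ℝ) : ℝ :=
  Function.invFunOn (stieltjesExt ν) (Set.Ici (rightEdge ν)) (z : EReal)

/-- The `R`-transform `R_ν(z) = K_ν(z) - 1/z`. -/
def rTransform (ν : Measure ℝ) (z : ℝ) : ℝ := stieltjesInv ν z - 1 / z

open Classical in
/-- `v(ν, x, θ) = R_ν(2θ)` if `2θ ≤ G_ν(x)`, and `x - 1/(2θ)` if `2θ > G_ν(x)`.
(At `θ = 0` the value is irrelevant, `v` being used only through the product `θ v`.) -/
def vParam (ν : Measure ℝ) (x θ : ℝ) : ℝ :=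
  if ((2 * θ : ℝ) : EReal) ≤ stieltjesExt ν x then rTransform ν (2 * θ) else x - 1 / (2 * θ)

/-- `J(ν, x, θ) = θ v - (1/2) ∫ log(1 + 2θ v - 2θ y) dν(y)` with `v = v(ν, x, θ)`. -/
def sphericalLimit (ν : Measure ℝ) (x θ : ℝ) : ℝ :=
  θ * vParam ν x θ -
    (1 / 2) * ∫ y, Real.log (1 + 2 * θ * vParam ν x θ - 2 * θ * y) ∂ν

/-- The semicircle law `σ(dx) = (1/2π) √(4 - x²) 1_{|x| ≤ 2} dx`
(`Real.sqrt` vanishes at negative numbers). -/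
def semicircle : Measure ℝ :=
  volume.withDensity (fun x => ENNReal.ofReal (1 / (2 * Real.pi) * Real.sqrt (4 - x ^ 2)))

/-! ### The rate function -/

/-- `Ī(x) = +∞` for `x < 2`, and `Ī(x) = sup_{θ ≥ 0} (J(σ, x, θ) - F̄(θ))` for `x ≥ 2`. -/
def upperRate {Ω : ℕ → Type*} [∀ N, MeasurableSpace (Ω N)] (P : ∀ N, Measure (Ω N))
    (X : ∀ N, Ω N → Matrix (Fin N) (Fin N) ℝ) (x : ℝ) : EReal :=
  if x < 2 then ⊤
  else ⨆ θ : {θ : ℝ // 0 ≤ θ},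
    ((sphericalLimit semicircle x θ.1 : ℝ) : EReal) - annealedLimsup P X θ.1

/-- A good rate function: `[0, ∞]`-valued, lower semicontinuous, with compact sublevel sets. -/
structure IsGoodRateFunction (I : ℝ → EReal) : Prop where
  nonneg : ∀ x, 0 ≤ I x
  lowerSemicontinuous : LowerSemicontinuous I
  isCompact_sublevel : ∀ a : ℝ, IsCompact {x | I x ≤ (a : EReal)}

end WignerLDP

end

/-!
# The rate function `Ī` is good and grows like `x² / (4A)`

Everything rests on two-sided bounds for `F̄` and for `J(σ, x, θ)`.

**The annealed integral.** Averaging over the matrix first, `E_X exp (θ N ⟨v, X v⟩)` is the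
exponential of a sum of values of `L` (`integral_exp_quadForm`). By symmetry of the law of the
entries `L` is nonnegative, even and nondecreasing in `|x|`, and `L(x) ≤ A x² / 2`; since `v` is a
unit vector this gives `0 ≤ F̄(θ) ≤ A θ²`. Conversely, for every `a < A` there is `C` with
`F̄(θ) ≥ a θ² - C` for all `θ ≥ 0` (`exists_le_annealedLimsup`). To see this, choose `x > 0` with
`L(x) ≥ b x² / 2`, where `a < b < A`; it exists because `A > 1 = 2 ψ(0)`. Consider the unit
vectors with about `2θ√N / x` coordinates at least `s`, `s² = x / (2θ√N)`: they carry almost all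
the mass, the products of such coordinates make each off-diagonal coefficient at least `x`, and all
other entries contribute nonnegatively. The resulting exponent is close to `b θ² N`. Comparing the
cone over this set, which contains an explicit box, with the unit ball shows that its probability
is at least `κ^N` for some `κ` that does not depend on `θ` (`le_uniformSphere_real_spikes`).

**The spherical integral.** The Stieltjes transform `G` of the semicircle law is strictly
decreasing, so that `v(σ, x, θ) = max x x_θ - 1/(2θ)`, where `x_θ` is `K(2θ)` or `2`. Hence
`J(σ, ·, θ)` is continuous on `[2, ∞)`, because the logarithmic potential is continuous up to the
edge, and the bounds `1/(x+2) ≤ G(x) ≤ 1/(x-2)` give `J(σ, x, θ) ≤ θ x + C` for `x ≥ 3` and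
`J(σ, x, θ) ≥ θ x - O(log x)` for `θ` of order `x`.

**Conclusion.** `Ī` is a supremum of lower semicontinuous functions. Optimizing `θ x - A θ²` and
`θ x - a θ²` over `θ` gives `x² / (4A) - O(log x) ≤ Ī(x) ≤ x² / (4a) + O(1)`.
-/

open scoped Pointwise

noncomputable section

namespace WignerLDP

/-! ### The semicircle law -/

theorem semicircle_le_restrict : semicircle ≤ volume.restrict (Set.Icc (-2 : ℝ) 2) := by
  have h : (fun x : ℝ => ENNReal.ofReal (1 / (2 * Real.pi) * Real.sqrt (4 - x ^ 2))) ≤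
      (Set.Icc (-2 : ℝ) 2).indicator (fun _ => (1 : ENNReal)) := by
    intro x
    by_cases hx : x ∈ Set.Icc (-2 : ℝ) 2
    · simp only [Set.indicator_of_mem hx]
      rw [ENNReal.ofReal_le_one]
      have h1 : Real.sqrt (4 - x ^ 2) ≤ 2 := by
        rw [Real.sqrt_le_left (by norm_num)]; nlinarith [sq_nonneg x]
      have h2 := Real.pi_gt_three
      rw [div_mul_eq_mul_div, div_le_one (by positivity)]
      linarith
    · have : 4 - x ^ 2 ≤ 0 := by
        by_contra hc
        exact hx ⟨by nlinarith, by nlinarith⟩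
      simp [Real.sqrt_eq_zero_of_nonpos this]
  have := withDensity_mono (μ := (volume : Measure ℝ)) (ae_of_all _ h)
  rwa [withDensity_indicator measurableSet_Icc, withDensity_const, one_smul] at this

theorem semicircle_univ : semicircle Set.univ = 1 := by
  have hint : ∫ x in (-2 : ℝ)..2, Real.sqrt (4 - x ^ 2) = 2 * Real.pi := by
    have h := intervalIntegral.integral_comp_mul_left (a := -1) (b := 1)
      (fun x : ℝ => Real.sqrt (4 - x ^ 2)) (c := 2) (by norm_num)
    have h2 : ∀ x : ℝ, Real.sqrt (4 - (2 * x) ^ 2) = 2 * Real.sqrt (1 - x ^ 2) := by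
      intro x
      rw [show 4 - (2 * x) ^ 2 = 2 ^ 2 * (1 - x ^ 2) by ring, Real.sqrt_mul (by norm_num),
        Real.sqrt_sq (by norm_num)]
    simp only [h2, intervalIntegral.integral_const_mul, integral_sqrt_one_sub_sq] at h
    norm_num at h
    linarith
  have hz : ∀ x ∉ Set.Ioc (-2 : ℝ) 2,
      ENNReal.ofReal (1 / (2 * Real.pi) * Real.sqrt (4 - x ^ 2)) = 0 := by
    intro x hx
    have : 4 - x ^ 2 ≤ 0 := by
      by_contra hc
      exact hx ⟨by nlinarith, by nlinarith⟩
    simp [Real.sqrt_eq_zero_of_nonpos this]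
  rw [semicircle, withDensity_apply _ MeasurableSet.univ, Measure.restrict_univ,
    ← setLIntegral_eq_of_support_subset (s := Set.Ioc (-2 : ℝ) 2)
      (Function.support_subset_iff'.2 hz),
    ← ofReal_integral_eq_lintegral_ofReal, ← intervalIntegral.integral_of_le (by norm_num),
    intervalIntegral.integral_const_mul, hint]
  · field_simp; simp
  · exact ((by fun_prop : Continuous fun x : ℝ => 1 / (2 * Real.pi) * Real.sqrt (4 - x ^ 2)
      ).integrableOn_Icc (a := -2) (b := 2)).mono_set Set.Ioc_subset_Icc_self
  · exact ae_of_all _ fun x => by positivity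

instance isProbabilityMeasure_semicircle : IsProbabilityMeasure semicircle := ⟨semicircle_univ⟩

theorem ae_semicircle_mem_Icc : ∀ᵐ y ∂semicircle, y ∈ Set.Icc (-2 : ℝ) 2 :=
  semicircle_le_restrict.absolutelyContinuous.ae_le (ae_restrict_mem measurableSet_Icc)

theorem ae_semicircle_lt_two : ∀ᵐ y ∂semicircle, y < 2 := by
  have : volume.restrict (Set.Icc (-2 : ℝ) 2) {2} = 0 := by simp
  have h3 := semicircle_le_restrict.absolutelyContinuous this
  have hne : ∀ᵐ y ∂semicircle, y ≠ 2 := by simpa [ae_iff] using h3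
  filter_upwards [ae_semicircle_mem_Icc, hne] with y hy hy2
  exact lt_of_le_of_ne hy.2 hy2

theorem two_mem_support_semicircle : (2 : ℝ) ∈ semicircle.support := by
  rw [Measure.mem_support_iff_forall]
  intro U hU
  obtain ⟨l, hl, hlU⟩ := exists_Ioc_subset_of_mem_nhds hU ⟨1, by norm_num⟩
  have hsub : Set.Ioo (max l 0) 2 ⊆ U := fun y hy =>
    hlU ⟨(le_max_left _ _).trans_lt hy.1, hy.2.le⟩
  refine lt_of_lt_of_le ?_ (measure_mono hsub)
  rw [semicircle, withDensity_apply _ measurableSet_Ioo, setLIntegral_pos_iff (by fun_prop)]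
  have : Function.support (fun x : ℝ =>
      ENNReal.ofReal (1 / (2 * Real.pi) * Real.sqrt (4 - x ^ 2))) ∩ Set.Ioo (max l 0) 2 =
      Set.Ioo (max l 0) 2 := by
    refine Set.inter_eq_right.2 fun y hy => ?_
    have hy0 : 0 < y := (le_max_right _ _).trans_lt hy.1
    have : 0 < Real.sqrt (4 - y ^ 2) := Real.sqrt_pos.2 (by nlinarith [hy.2])
    have : 0 < 1 / (2 * Real.pi) * Real.sqrt (4 - y ^ 2) := by positivity
    simpa [Function.mem_support] using this
  rw [this, Real.volume_Ioo]
  simpa using hl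

theorem rightEdge_semicircle : rightEdge semicircle = 2 := by
  have hsub : semicircle.support ⊆ Set.Icc (-2 : ℝ) 2 :=
    Measure.support_subset_of_isClosed isClosed_Icc ae_semicircle_mem_Icc
  refine le_antisymm (csSup_le ⟨2, two_mem_support_semicircle⟩ fun y hy => (hsub hy).2) ?_
  exact le_csSup ⟨2, fun y hy => (hsub hy).2⟩ two_mem_support_semicircle

/-- The logarithmic singularity at the edge of the semicircle law is integrable. -/
theorem integrable_log_two_sub : Integrable (fun y => Real.log (2 - y)) semicircle := by
  have h : IntervalIntegrable (fun y => Real.log (2 - y)) volume (-2) 2 := by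
    have := (intervalIntegral.intervalIntegrable_log' (a := 4) (b := 0)).comp_sub_left 2
    norm_num at this
    exact this
  rw [intervalIntegrable_iff_integrableOn_Icc_of_le (by norm_num)] at h
  exact Integrable.mono_measure h semicircle_le_restrict

theorem integrable_log_sub {x : ℝ} (hx : 2 ≤ x) :
    Integrable (fun y => Real.log (x - y)) semicircle := by
  refine ((integrable_log_two_sub.abs).add (integrable_const |Real.log (x + 2)|)).mono'
    (Real.measurable_log.comp (measurable_const.sub measurable_id)).aestronglyMeasurable ?_
  filter_upwards [ae_semicircle_mem_Icc, ae_semicircle_lt_two] with y hy hy2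
  have h3 : 0 < 2 - y := by linarith
  have h4 : Real.log (2 - y) ≤ Real.log (x - y) := Real.log_le_log h3 (by linarith)
  have h5 : Real.log (x - y) ≤ Real.log (x + 2) :=
    Real.log_le_log (by linarith) (by linarith [hy.1])
  simp only [Real.norm_eq_abs, Pi.add_apply]
  rw [abs_le]
  constructor
  · linarith [neg_abs_le (Real.log (2 - y)), abs_nonneg (Real.log (x + 2))]
  · linarith [le_abs_self (Real.log (x + 2)), abs_nonneg (Real.log (2 - y))]

/-! ### The Stieltjes transform of the semicircle law -/

theorem integrable_inv_sub {x : ℝ} (hx : 2 < x) :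
    Integrable (fun y => 1 / (x - y)) semicircle := by
  refine Integrable.of_bound (C := 1 / (x - 2))
    ((measurable_const.sub measurable_id).const_div 1).aestronglyMeasurable ?_
  filter_upwards [ae_semicircle_mem_Icc] with y hy
  rw [Real.norm_of_nonneg (by apply one_div_nonneg.2; linarith [hy.2])]
  exact one_div_le_one_div_of_le (by linarith) (by linarith [hy.2])

theorem stieltjes_semicircle_le {x : ℝ} (hx : 2 < x) :
    stieltjes semicircle x ≤ 1 / (x - 2) := by
  have : stieltjes semicircle x ≤ ∫ _, 1 / (x - 2) ∂semicircle := by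
    refine integral_mono_ae (integrable_inv_sub hx) (integrable_const _) ?_
    filter_upwards [ae_semicircle_mem_Icc] with y hy
    exact one_div_le_one_div_of_le (by linarith) (by linarith [hy.2])
  simpa using this

theorem le_stieltjes_semicircle {x : ℝ} (hx : 2 < x) :
    1 / (x + 2) ≤ stieltjes semicircle x := by
  have : ∫ _, 1 / (x + 2) ∂semicircle ≤ stieltjes semicircle x := by
    refine integral_mono_ae (integrable_const _) (integrable_inv_sub hx) ?_
    filter_upwards [ae_semicircle_mem_Icc] with y hy
    exact one_div_le_one_div_of_le (by linarith [hy.2]) (by linarith [hy.1])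
  simpa using this

/-- The gap is bounded below explicitly, through
`1/(x-y) - 1/(x'-y) = (x'-x)/((x-y)(x'-y))`. -/
theorem stieltjes_semicircle_strictAntiOn :
    StrictAntiOn (stieltjes semicircle) (Set.Ioi 2) := by
  intro x hx x' hx' hlt
  have hx2 : 2 < x := hx
  have hx2' : 2 < x' := hx'
  have key : stieltjes semicircle x' + (x' - x) / ((x + 2) * (x' + 2)) ≤
      stieltjes semicircle x := by
    have : ∫ y, (1 / (x' - y) + (x' - x) / ((x + 2) * (x' + 2))) ∂semicircle ≤
        stieltjes semicircle x := by
      refine integral_mono_ae ((integrable_inv_sub hx').add (integrable_const _))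
        (integrable_inv_sub hx) ?_
      filter_upwards [ae_semicircle_mem_Icc] with y hy
      have h1 : 0 < x - y := by linarith [hy.2]
      have h2 : 0 < x' - y := by linarith [hy.2]
      have h3 : (x' - x) / ((x + 2) * (x' + 2)) ≤ (x' - x) / ((x - y) * (x' - y)) := by
        refine div_le_div_of_nonneg_left (by linarith) (by positivity) ?_
        exact mul_le_mul (by linarith [hy.1]) (by linarith [hy.1]) h2.le (by linarith)
      have h4 : 1 / (x - y) = 1 / (x' - y) + (x' - x) / ((x - y) * (x' - y)) := by
        field_simp; ring
      change 1 / (x' - y) + (x' - x) / ((x + 2) * (x' + 2)) ≤ 1 / (x - y)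
      rw [h4]; linarith
    rw [integral_add (integrable_inv_sub hx') (integrable_const _)] at this
    simpa [stieltjes] using this
  have : 0 < (x' - x) / ((x + 2) * (x' + 2)) := by
    apply div_pos <;> nlinarith
  linarith

theorem continuousOn_stieltjes_semicircle :
    ContinuousOn (stieltjes semicircle) (Set.Ioi 2) := by
  intro x hx
  have hx2 : 2 < x := hx
  refine ContinuousAt.continuousWithinAt ?_
  refine continuousAt_of_dominated (bound := fun _ => 1 / ((x - 2) / 2))
    (Eventually.of_forall fun _ =>
      ((measurable_const.sub measurable_id).const_div 1).aestronglyMeasurable) ?_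
    (integrable_const _) ?_
  · filter_upwards [lt_mem_nhds (show (x + 2) / 2 < x by linarith)] with x' hx'
    filter_upwards [ae_semicircle_mem_Icc] with y hy
    rw [Real.norm_of_nonneg (by apply one_div_nonneg.2; linarith [hy.2])]
    exact one_div_le_one_div_of_le (by linarith) (by linarith [hy.2])
  · filter_upwards [ae_semicircle_mem_Icc] with y hy
    have : x - y ≠ 0 := by linarith [hy.2]
    fun_prop (disch := assumption)

theorem stieltjesExt_semicircle_of_two_lt {x : ℝ} (hx : 2 < x) :
    stieltjesExt semicircle x = stieltjes semicircle x := by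
  rw [stieltjesExt, rightEdge_semicircle, if_neg hx.ne']

theorem stieltjes_lt_stieltjesExt_two {x : ℝ} (hx : 2 < x) :
    (stieltjes semicircle x : EReal) < stieltjesExt semicircle 2 := by
  rw [stieltjesExt, rightEdge_semicircle, if_pos rfl]
  obtain ⟨m, h2m, hmx⟩ := exists_between hx
  refine lt_of_lt_of_le (b := (stieltjes semicircle m : EReal))
    (EReal.coe_lt_coe (stieltjes_semicircle_strictAntiOn h2m hx hmx)) ?_
  refine le_limsup_of_frequently_le (Eventually.frequently ?_)
  filter_upwards [Ioo_mem_nhdsGT h2m] with t ht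
  exact EReal.coe_le_coe (stieltjes_semicircle_strictAntiOn ht.1 h2m ht.2).le

theorem stieltjesExt_semicircle_strictAntiOn :
    StrictAntiOn (stieltjesExt semicircle) (Set.Ici 2) := by
  intro x hx x' hx' hlt
  have hx2' : 2 < x' := lt_of_le_of_lt hx hlt
  rcases eq_or_lt_of_le (show (2 : ℝ) ≤ x from hx) with h | h
  · rw [← h, stieltjesExt_semicircle_of_two_lt hx2']
    exact stieltjes_lt_stieltjesExt_two hx2'
  · rw [stieltjesExt_semicircle_of_two_lt hx2', stieltjesExt_semicircle_of_two_lt h]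
    exact EReal.coe_lt_coe (stieltjes_semicircle_strictAntiOn h hx2' hlt)

/-- Every `z ∈ (0, G(2)]` is a value of the Stieltjes transform on `[2, ∞)`. -/
theorem exists_stieltjesExt_semicircle_eq {z : ℝ} (hz : 0 < z)
    (hz2 : (z : EReal) ≤ stieltjesExt semicircle 2) :
    ∃ x ∈ Set.Ici (2 : ℝ), stieltjesExt semicircle x = z := by
  rcases eq_or_lt_of_le hz2 with h | h
  · exact ⟨2, Set.self_mem_Ici, h.symm⟩
  · rw [stieltjesExt, rightEdge_semicircle, if_pos rfl] at h
    have hf := frequently_lt_of_lt_limsup (by isBoundedDefault) h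
    obtain ⟨a, hza, ha⟩ := (hf.and_eventually self_mem_nhdsWithin).exists
    have ha2 : (2 : ℝ) < a := ha
    have hza' : z < stieltjes semicircle a := EReal.coe_lt_coe_iff.1 hza
    -- the transform is at most `1 / (x - 2) ≤ z` at the point `b`
    set b := max a (2 + 1 / z) with hb
    have hb2 : 2 < b := ha2.trans_le (le_max_left _ _)
    have hbz : stieltjes semicircle b ≤ z := by
      refine (stieltjes_semicircle_le hb2).trans ?_
      rw [div_le_iff₀ (by linarith)]
      have h1 : 1 / z ≤ b - 2 := by linarith [le_max_right a (2 + 1 / z)]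
      rw [div_le_iff₀ hz] at h1
      linarith
    have hsub : Set.Icc a b ⊆ Set.Ioi 2 := fun y hy => ha2.trans_le hy.1
    obtain ⟨x, hx, hxz⟩ := intermediate_value_Icc' (le_max_left _ _)
      (continuousOn_stieltjes_semicircle.mono hsub) ⟨hbz, hza'.le⟩
    refine ⟨x, Set.mem_Ici.2 (le_of_lt (Set.mem_Ioi.1 (hsub hx))), ?_⟩
    rw [stieltjesExt_semicircle_of_two_lt (hsub hx), hxz]

theorem stieltjesInv_semicircle_spec {z : ℝ} (hz : 0 < z)
    (hz2 : (z : EReal) ≤ stieltjesExt semicircle 2) :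
    2 ≤ stieltjesInv semicircle z ∧
      stieltjesExt semicircle (stieltjesInv semicircle z) = z := by
  have h : ∃ x ∈ Set.Ici (rightEdge semicircle), stieltjesExt semicircle x = z := by
    rw [rightEdge_semicircle]; exact exists_stieltjesExt_semicircle_eq hz hz2
  refine ⟨?_, Function.invFunOn_eq h⟩
  have := Function.invFunOn_mem h
  rw [rightEdge_semicircle] at this
  rwa [stieltjesInv, rightEdge_semicircle]

/-! ### The limit of spherical integrals for the semicircle law -/

/-- The point `x_θ ∈ [2, ∞)` below which `x ↦ J(σ, x, θ)` is constant: `K(2θ)` if `2θ` is a value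
of the Stieltjes transform on `[2, ∞)`, and `2` otherwise. -/
def threshold (θ : ℝ) : ℝ :=
  if ((2 * θ : ℝ) : EReal) ≤ stieltjesExt semicircle 2 then stieltjesInv semicircle (2 * θ) else 2

theorem vParam_semicircle {x θ : ℝ} (hx : 2 ≤ x) (hθ : 0 < θ) :
    vParam semicircle x θ = max x (threshold θ) - 1 / (2 * θ) := by
  have h2θ : 0 < 2 * θ := by linarith
  unfold vParam threshold rTransform
  by_cases h2 : ((2 * θ : ℝ) : EReal) ≤ stieltjesExt semicircle 2
  · obtain ⟨hK, hGK⟩ := stieltjesInv_semicircle_spec h2θ h2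
    rw [if_pos h2]
    have hiff : ((2 * θ : ℝ) : EReal) ≤ stieltjesExt semicircle x ↔
        x ≤ stieltjesInv semicircle (2 * θ) := by
      conv_lhs => rw [← hGK]
      exact stieltjesExt_semicircle_strictAntiOn.le_iff_ge hK hx
    by_cases h : x ≤ stieltjesInv semicircle (2 * θ)
    · rw [if_pos (hiff.2 h), max_eq_right h]
    · rw [if_neg (mt hiff.1 h), max_eq_left (not_le.1 h).le]
  · rw [if_neg h2, max_eq_left hx, if_neg]
    exact fun h => h2 (h.trans (stieltjesExt_semicircle_strictAntiOn.antitoneOn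
      Set.self_mem_Ici hx hx))

/-- The function `θ x - 1/2 - (1/2) ∫ log(2θ (x - y)) dσ(y)`, which is `J(σ, x, θ)` for
`x ≥ x_θ`. -/
def tiltedLog (θ x : ℝ) : ℝ :=
  θ * x - 1 / 2 - (1 / 2) * (Real.log (2 * θ) + ∫ y, Real.log (x - y) ∂semicircle)

theorem sphericalLimit_semicircle {x θ : ℝ} (hx : 2 ≤ x) (hθ : 0 < θ) :
    sphericalLimit semicircle x θ = tiltedLog θ (max x (threshold θ)) := by
  have hm : 2 ≤ max x (threshold θ) := hx.trans (le_max_left _ _)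
  have hθ' : θ ≠ 0 := hθ.ne'
  rw [sphericalLimit, vParam_semicircle hx hθ, tiltedLog]
  set m := max x (threshold θ)
  have h1 : θ * (m - 1 / (2 * θ)) = θ * m - 1 / 2 := by field_simp
  have h2 : ∫ y, Real.log (1 + 2 * θ * (m - 1 / (2 * θ)) - 2 * θ * y) ∂semicircle =
      ∫ y, (Real.log (2 * θ) + Real.log (m - y)) ∂semicircle := by
    refine integral_congr_ae ?_
    filter_upwards [ae_semicircle_lt_two] with y h3
    rw [← Real.log_mul (by positivity) (by linarith)]
    congr 1
    field_simp; ring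
  rw [h1, h2, integral_add (integrable_const _) (integrable_log_sub hm)]
  simp

theorem sphericalLimit_zero (ν : Measure ℝ) (x : ℝ) : sphericalLimit ν x 0 = 0 := by
  simp [sphericalLimit]

/-- The logarithmic potential of the semicircle law is continuous up to the edge. -/
theorem continuousOn_integral_log_sub :
    ContinuousOn (fun x => ∫ y, Real.log (x - y) ∂semicircle) (Set.Ici 2) := by
  intro x hx
  have hx2 : 2 ≤ x := hx
  refine continuousWithinAt_of_dominated
    (bound := fun y => |Real.log (2 - y)| + |Real.log (x + 1 + 2)|)
    (Eventually.of_forall fun _ =>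
      (Real.measurable_log.comp (measurable_const.sub measurable_id)).aestronglyMeasurable) ?_
    (integrable_log_two_sub.abs.add (integrable_const _)) ?_
  · filter_upwards [self_mem_nhdsWithin,
      mem_nhdsWithin_of_mem_nhds (gt_mem_nhds (show x < x + 1 by linarith))] with x' h2x' hx'
    filter_upwards [ae_semicircle_mem_Icc, ae_semicircle_lt_two] with y hy hy2
    have h2x : 2 ≤ x' := h2x'
    have h4 : Real.log (2 - y) ≤ Real.log (x' - y) :=
      Real.log_le_log (by linarith) (by linarith)
    have h5 : Real.log (x' - y) ≤ Real.log (x + 1 + 2) :=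
      Real.log_le_log (by linarith) (by linarith [hy.1])
    rw [Real.norm_eq_abs, abs_le]
    constructor
    · linarith [neg_abs_le (Real.log (2 - y)), abs_nonneg (Real.log (x + 1 + 2))]
    · linarith [le_abs_self (Real.log (x + 1 + 2)), abs_nonneg (Real.log (2 - y))]
  · filter_upwards [ae_semicircle_lt_two] with y hy
    have : x - y ≠ 0 := by linarith
    exact ContinuousAt.continuousWithinAt (by fun_prop (disch := assumption))

theorem continuousOn_sphericalLimit_semicircle {θ : ℝ} (hθ : 0 ≤ θ) :
    ContinuousOn (fun x => sphericalLimit semicircle x θ) (Set.Ici 2) := by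
  rcases hθ.eq_or_lt with rfl | hθ
  · simpa only [sphericalLimit_zero] using continuousOn_const
  have hH : ContinuousOn (tiltedLog θ) (Set.Ici 2) :=
    ((continuousOn_const.mul continuousOn_id).sub continuousOn_const).sub
      (continuousOn_const.mul (continuousOn_const.add continuousOn_integral_log_sub))
  have hc : ContinuousOn (fun x => tiltedLog θ (max x (threshold θ))) (Set.Ici 2) :=
    hH.comp (by fun_prop) fun x hx => (show (2 : ℝ) ≤ x from hx).trans (le_max_left _ _)
  exact hc.congr fun x hx => sphericalLimit_semicircle hx hθ

theorem log_sub_two_le_integral {x : ℝ} (hx : 2 < x) :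
    Real.log (x - 2) ≤ ∫ y, Real.log (x - y) ∂semicircle := by
  have : ∫ _, Real.log (x - 2) ∂semicircle ≤ ∫ y, Real.log (x - y) ∂semicircle := by
    refine integral_mono_ae (integrable_const _) (integrable_log_sub hx.le) ?_
    filter_upwards [ae_semicircle_mem_Icc] with y hy
    exact Real.log_le_log (by linarith) (by linarith [hy.2])
  simpa using this

theorem integral_le_log_add_two {x : ℝ} (hx : 2 < x) :
    ∫ y, Real.log (x - y) ∂semicircle ≤ Real.log (x + 2) := by
  have : ∫ y, Real.log (x - y) ∂semicircle ≤ ∫ _, Real.log (x + 2) ∂semicircle := by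
    refine integral_mono_ae (integrable_log_sub hx.le) (integrable_const _) ?_
    filter_upwards [ae_semicircle_mem_Icc] with y hy
    exact Real.log_le_log (by linarith [hy.2]) (by linarith [hy.1])
  simpa using this

theorem stieltjes_le_two_mul_of_threshold_le {x θ : ℝ} (hθ : 0 < θ) (hx : 2 < x)
    (h : threshold θ ≤ x) : stieltjes semicircle x ≤ 2 * θ := by
  unfold threshold at h
  rw [← EReal.coe_le_coe_iff, ← stieltjesExt_semicircle_of_two_lt hx]
  split_ifs at h with h2
  · obtain ⟨hK, hGK⟩ := stieltjesInv_semicircle_spec (by linarith : 0 < 2 * θ) h2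
    rw [← hGK]
    exact stieltjesExt_semicircle_strictAntiOn.antitoneOn hK hx.le h
  · exact (stieltjesExt_semicircle_strictAntiOn.antitoneOn Set.self_mem_Ici hx.le h).trans
      (not_le.1 h2).le

theorem two_mul_eq_stieltjes_of_lt_threshold {θ : ℝ} (hθ : 0 < θ) (h : 2 < threshold θ) :
    stieltjes semicircle (threshold θ) = 2 * θ := by
  have h' := h
  unfold threshold at h ⊢
  split_ifs at h ⊢ with h2
  · have := (stieltjesInv_semicircle_spec (by linarith : 0 < 2 * θ) h2).2
    rw [stieltjesExt_semicircle_of_two_lt h] at this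
    exact_mod_cast this
  · exact absurd h (lt_irrefl _)

/-- Upper bound `J(σ, x, θ) ≤ θ x + C`, uniformly in `θ ≥ 0` and `x ≥ 3`. -/
theorem sphericalLimit_semicircle_le {x θ : ℝ} (hx : 3 ≤ x) (hθ : 0 ≤ θ) :
    sphericalLimit semicircle x θ ≤ θ * x + (3 + Real.log 5) := by
  have hlog5 : 0 < Real.log 5 := Real.log_pos (by norm_num)
  rcases hθ.eq_or_lt with rfl | hθ
  · rw [sphericalLimit_zero]; linarith
  rw [sphericalLimit_semicircle (by linarith) hθ]
  set m := max x (threshold θ) with hm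
  have hm3 : 3 ≤ m := hx.trans (le_max_left _ _)
  have hG : stieltjes semicircle m ≤ 2 * θ :=
    stieltjes_le_two_mul_of_threshold_le hθ (by linarith) (le_max_right _ _)
  have h1 : 1 / (m + 2) ≤ 2 * θ := (le_stieltjes_semicircle (by linarith)).trans hG
  have h2 : -Real.log 5 ≤ Real.log (2 * θ) + ∫ y, Real.log (m - y) ∂semicircle := by
    have h3 : Real.log (1 / 5) ≤ Real.log (2 * θ * (m - 2)) := by
      refine Real.log_le_log (by norm_num) ?_
      have : 1 / 5 ≤ 1 / (m + 2) * (m - 2) := by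
        rw [div_mul_eq_mul_div, div_le_div_iff₀ (by norm_num) (by linarith)]; linarith
      exact this.trans (mul_le_mul_of_nonneg_right h1 (by linarith))
    rw [Real.log_mul (by positivity) (by linarith), one_div, Real.log_inv] at h3
    linarith [log_sub_two_le_integral (show 2 < m by linarith)]
  have h4 : θ * m ≤ θ * x + 5 / 2 := by
    rcases le_total (threshold θ) x with h | h
    · rw [hm, max_eq_left h]; linarith
    · -- here `2θ = G(m) ≤ 1 / (m - 2)`, so that `θ m` is bounded
      have hmt : m = threshold θ := max_eq_right h
      have h5 := two_mul_eq_stieltjes_of_lt_threshold hθ (by linarith)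
      have h6 := stieltjes_semicircle_le (x := threshold θ) (by linarith)
      rw [← hmt] at h5 h6
      rw [h5, le_div_iff₀ (by linarith)] at h6
      nlinarith [mul_nonneg hθ.le (by linarith : 0 ≤ x), mul_nonneg hθ.le (by linarith : 0 ≤ m - 3)]
  unfold tiltedLog
  linarith

theorem le_sphericalLimit_semicircle {x θ : ℝ} (hx : 2 < x) (h : 1 < 2 * θ * (x - 2)) :
    θ * x - 1 / 2 - 1 / 2 * Real.log (2 * θ * (x + 2)) ≤ sphericalLimit semicircle x θ := by
  have hθ : 0 < θ := by
    by_contra hc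
    nlinarith
  have hlt : stieltjes semicircle x < 2 * θ := by
    refine (stieltjes_semicircle_le hx).trans_lt ?_
    rw [div_lt_iff₀ (by linarith)]; exact h
  have hv : threshold θ ≤ x := by
    by_contra hc
    have hc := not_le.1 hc
    have h5 := two_mul_eq_stieltjes_of_lt_threshold hθ (hx.trans hc)
    have := stieltjes_semicircle_strictAntiOn hx (hx.trans hc) hc
    linarith
  rw [sphericalLimit_semicircle hx.le hθ, max_eq_left hv, tiltedLog,
    Real.log_mul (by positivity) (by linarith)]
  linarith [integral_le_log_add_two hx]

/-! ### The log-Laplace transform of the entries -/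

namespace SubGaussianEntries

variable {μ : Measure ℝ} {A B : ℝ}

theorem integral_exp_neg (hμ : SubGaussianEntries μ A B) (x : ℝ) :
    ∫ t, Real.exp (-(x * t)) ∂μ = ∫ t, Real.exp (x * t) ∂μ := by
  conv_rhs => rw [← hμ.symm]
  rw [integral_map (by fun_prop) (by fun_prop)]
  simp

theorem integrable_cosh (hμ : SubGaussianEntries μ A B) (x : ℝ) :
    Integrable (fun t => Real.cosh (x * t)) μ := by
  have h := hμ.integrable_exp (-x)
  simp only [neg_mul] at h
  simp only [Real.cosh_eq]
  exact ((hμ.integrable_exp x).add h).div_const 2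

theorem integral_exp_eq_integral_cosh (hμ : SubGaussianEntries μ A B) (x : ℝ) :
    ∫ t, Real.exp (x * t) ∂μ = ∫ t, Real.cosh (x * t) ∂μ := by
  have h := hμ.integrable_exp (-x)
  simp only [neg_mul] at h
  simp only [Real.cosh_eq]
  rw [integral_div, integral_add (hμ.integrable_exp x) h, hμ.integral_exp_neg]
  ring

theorem one_le_integral_exp [IsProbabilityMeasure μ] (hμ : SubGaussianEntries μ A B) (x : ℝ) :
    1 ≤ ∫ t, Real.exp (x * t) ∂μ := by
  rw [hμ.integral_exp_eq_integral_cosh]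
  have := integral_mono (integrable_const (1 : ℝ)) (hμ.integrable_cosh x)
    fun t => Real.one_le_cosh (x * t)
  simpa using this

theorem exp_logLaplace [IsProbabilityMeasure μ] (hμ : SubGaussianEntries μ A B) (x : ℝ) :
    Real.exp (logLaplace μ x) = ∫ t, Real.exp (x * t) ∂μ :=
  Real.exp_log (one_pos.trans_le (hμ.one_le_integral_exp x))

theorem logLaplace_nonneg [IsProbabilityMeasure μ] (hμ : SubGaussianEntries μ A B) (x : ℝ) :
    0 ≤ logLaplace μ x :=
  Real.log_nonneg (hμ.one_le_integral_exp x)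

/-- By symmetry `e^L` is an average of the functions `x ↦ cosh (t x)`. -/
theorem logLaplace_le_logLaplace [IsProbabilityMeasure μ] (hμ : SubGaussianEntries μ A B)
    {x y : ℝ} (h : |x| ≤ |y|) : logLaplace μ x ≤ logLaplace μ y := by
  refine Real.log_le_log (one_pos.trans_le (hμ.one_le_integral_exp x)) ?_
  rw [hμ.integral_exp_eq_integral_cosh, hμ.integral_exp_eq_integral_cosh]
  refine integral_mono (hμ.integrable_cosh x) (hμ.integrable_cosh y) fun t => ?_
  rw [Real.cosh_le_cosh, abs_mul, abs_mul]
  exact mul_le_mul_of_nonneg_right h (abs_nonneg t)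

theorem logLaplace_le [IsProbabilityMeasure μ] (hμ : SubGaussianEntries μ A B) (x : ℝ) :
    logLaplace μ x ≤ A / 2 * x ^ 2 := by
  rcases eq_or_ne x 0 with rfl | hx
  · simp [logLaplace]
  · have h : psi μ x ≤ A / 2 := hμ.isLUB_psi.1 ⟨x, rfl⟩
    rw [psi, if_neg hx, div_le_iff₀ (by positivity)] at h
    exact h

/-- Since `A > 1 = 2 ψ(0)`, the supremum of `ψ` is approached at nonzero points. -/
theorem exists_lt_logLaplace [IsProbabilityMeasure μ] (hμ : SubGaussianEntries μ A B) {a : ℝ}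
    (ha : a < A) : ∃ x, 0 < x ∧ a / 2 * x ^ 2 ≤ logLaplace μ x := by
  have hlt : max (1 / 2) (a / 2) < A / 2 := max_lt (by linarith [hμ.one_lt]) (by linarith)
  obtain ⟨_, ⟨x, rfl⟩, hx, -⟩ := hμ.isLUB_psi.exists_between hlt
  have hx0 : x ≠ 0 := by
    rintro rfl
    simp [psi] at hx
  rw [psi, if_neg hx0, max_lt_iff] at hx
  refine ⟨|x|, abs_pos.2 hx0, ?_⟩
  have h2 := hx.2
  rw [lt_div_iff₀ (by positivity)] at h2
  rw [sq_abs]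
  exact h2.le.trans (hμ.logLaplace_le_logLaplace (by simp))

end SubGaussianEntries

/-! ### Averaging over the matrix -/

theorem sum_upper_triangle {N : ℕ} (h : Fin N → Fin N → ℝ) (hs : ∀ i j, h i j = h j i) :
    ∑ p : {p : Fin N × Fin N // p.1 ≤ p.2},
      (if p.1.1 = p.1.2 then 1 else 2) * h p.1.1 p.1.2 = ∑ i, ∑ j, h i j := by
  have h1 : ∑ p : {p : Fin N × Fin N // p.1 ≤ p.2},
      (if p.1.1 = p.1.2 then 1 else 2) * h p.1.1 p.1.2 =
      ∑ i, ∑ j, if i ≤ j then (if i = j then 1 else 2) * h i j else 0 := by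
    rw [← Finset.sum_subtype (Finset.univ.filter fun p : Fin N × Fin N => p.1 ≤ p.2) (by simp)
      (fun p : Fin N × Fin N => (if p.1 = p.2 then 1 else 2) * h p.1 p.2), Finset.sum_filter,
      ← Finset.univ_product_univ, Finset.sum_product]
  have h2 : ∑ i, ∑ j, h i j =
      ∑ i, ∑ j, (if i ≤ j then h i j else 0) + ∑ i, ∑ j, (if i < j then h i j else 0) := by
    have h3 : ∑ i, ∑ j, (if i < j then h i j else 0) = ∑ i, ∑ j, if j < i then h i j else 0 := by
      rw [Finset.sum_comm]
      simp only [fun i j => hs i j]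
    rw [h3, ← Finset.sum_add_distrib]
    refine Finset.sum_congr rfl fun i _ => ?_
    rw [← Finset.sum_add_distrib]
    refine Finset.sum_congr rfl fun j _ => ?_
    rcases le_or_gt i j with hij | hij
    · simp [hij, not_lt.2 hij]
    · simp [hij, not_le.2 hij]
  rw [h1, h2, ← Finset.sum_add_distrib]
  refine Finset.sum_congr rfl fun i _ => ?_
  rw [← Finset.sum_add_distrib]
  refine Finset.sum_congr rfl fun j _ => ?_
  rcases lt_trichotomy i j with hij | rfl | hij
  · simp [hij, hij.le, hij.ne]; ring
  · simp
  · simp [not_lt.2 hij.le, not_le.2 hij]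

/-- The coefficient of the normalized entry (`√N X i j` off the diagonal, `√(N/2) X i i` on it)
in `θ N ⟨v, X v⟩`. -/
def entryCoeff {N : ℕ} (θ : ℝ) (v : Fin N → ℝ) (p : Fin N × Fin N) : ℝ :=
  if p.1 = p.2 then θ * Real.sqrt (2 * N) * (v p.1 * v p.2)
  else 2 * θ * Real.sqrt N * (v p.1 * v p.2)

/-- The logarithm of `E_X exp (θ N ⟨v, X v⟩)`. -/
def quadLaplace (μ : Measure ℝ) {N : ℕ} (θ : ℝ) (v : Fin N → ℝ) : ℝ :=
  ∑ p : {p : Fin N × Fin N // p.1 ≤ p.2}, logLaplace μ (entryCoeff θ v p.1)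

section

variable {μ : Measure ℝ} {A B : ℝ} {Ω : Type*} [MeasurableSpace Ω] {P : Measure Ω} {N : ℕ}
  {X : Ω → Matrix (Fin N) (Fin N) ℝ}

theorem IsWigner.aemeasurable_of_le (hX : IsWigner μ P N X) {i j : Fin N} (hij : i ≤ j) :
    AEMeasurable (fun ω => X ω i j) P := by
  have hN : (0 : ℝ) < N := by exact_mod_cast i.pos
  rcases hij.eq_or_lt with rfl | hij
  · have h := (hX.law_diag i).aemeasurable.const_mul (Real.sqrt (N / 2))⁻¹
    have : Real.sqrt (N / 2) ≠ 0 := (Real.sqrt_pos.2 (by positivity)).ne'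
    simpa only [inv_mul_cancel_left₀ this] using h
  · have h := (hX.law_offDiag i j hij).aemeasurable.const_mul (Real.sqrt N)⁻¹
    have : Real.sqrt N ≠ 0 := (Real.sqrt_pos.2 (by positivity)).ne'
    simpa only [inv_mul_cancel_left₀ this] using h

theorem IsWigner.aemeasurable (hX : IsWigner μ P N X) (i j : Fin N) :
    AEMeasurable (fun ω => X ω i j) P := by
  rcases le_total i j with h | h
  · exact hX.aemeasurable_of_le h
  · simpa only [fun ω => (hX.symm ω).apply i j] using hX.aemeasurable_of_le h

theorem quadForm_eq_sum (M : Matrix (Fin N) (Fin N) ℝ) (hM : M.IsSymm) (θ : ℝ)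
    (v : Fin N → ℝ) :
    θ * N * (v ⬝ᵥ M.mulVec v) = ∑ p : {p : Fin N × Fin N // p.1 ≤ p.2},
      entryCoeff θ v p.1 *
        ((if p.1.1 = p.1.2 then Real.sqrt (N / 2) else Real.sqrt N) * M p.1.1 p.1.2) := by
  have h := sum_upper_triangle (fun i j => θ * N * (v i * (M i j * v j)))
    fun i j => by rw [hM.apply]; ring
  have h2 : θ * N * (v ⬝ᵥ M.mulVec v) = ∑ i, ∑ j, θ * N * (v i * (M i j * v j)) := by
    simp only [dotProduct, Matrix.mulVec, Finset.mul_sum]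
  rw [h2, ← h]
  refine Finset.sum_congr rfl fun p _ => ?_
  unfold entryCoeff
  split_ifs with hp
  · have h3 : Real.sqrt (2 * N) * Real.sqrt (N / 2) = N := by
      rw [← Real.sqrt_mul (by positivity), show (2 * N * (N / 2) : ℝ) = N ^ 2 by ring,
        Real.sqrt_sq (by positivity)]
    linear_combination (-(θ * v p.1.1 * v p.1.2 * M p.1.1 p.1.2)) * h3
  · have h3 : Real.sqrt N * Real.sqrt N = N := Real.mul_self_sqrt (by positivity)
    linear_combination (-(2 * θ * v p.1.1 * v p.1.2 * M p.1.1 p.1.2)) * h3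

variable [IsProbabilityMeasure μ]

theorem integral_exp_quadForm (hμ : SubGaussianEntries μ A B) (hX : IsWigner μ P N X) (θ : ℝ)
    (v : Fin N → ℝ) :
    ∫ ω, Real.exp (θ * N * (v ⬝ᵥ (X ω).mulVec v)) ∂P = Real.exp (quadLaplace μ θ v) := by
  have h1 : ∀ ω, Real.exp (θ * N * (v ⬝ᵥ (X ω).mulVec v)) =
      ∏ p : {p : Fin N × Fin N // p.1 ≤ p.2}, Real.exp (entryCoeff θ v p.1 *
        ((if p.1.1 = p.1.2 then Real.sqrt (N / 2) else Real.sqrt N) * X ω p.1.1 p.1.2)) :=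
    fun ω => by rw [quadForm_eq_sum (X ω) (hX.symm ω), Real.exp_sum]
  simp only [h1]
  rw [hX.indep.integral_fun_prod_comp
    (f := fun p x => Real.exp (entryCoeff θ v p.1 *
        ((if p.1.1 = p.1.2 then Real.sqrt (N / 2) else Real.sqrt N) * x)))
    (fun p => hX.aemeasurable_of_le p.2) (fun p => by fun_prop), quadLaplace, Real.exp_sum]
  refine Finset.prod_congr rfl fun p _ => ?_
  rw [hμ.exp_logLaplace]
  have hlaw : HasLaw (fun ω => (if p.1.1 = p.1.2 then Real.sqrt (N / 2) else Real.sqrt N) *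
      X ω p.1.1 p.1.2) μ P := by
    obtain ⟨⟨i, j⟩, hij⟩ := p
    rcases eq_or_lt_of_le hij with h | h
    · simp only at h
      subst h
      simpa using hX.law_diag i
    · simp only at h
      simpa [h.ne] using hX.law_offDiag i j h
  exact hlaw.integral_comp (f := fun t => Real.exp (entryCoeff θ v p.1 * t)) (by fun_prop)

theorem quadLaplace_nonneg (hμ : SubGaussianEntries μ A B) (θ : ℝ) (v : Fin N → ℝ) :
    0 ≤ quadLaplace μ θ v :=
  Finset.sum_nonneg fun _ _ => hμ.logLaplace_nonneg _

theorem quadLaplace_le (hμ : SubGaussianEntries μ A B) (θ : ℝ) (v : Fin N → ℝ) :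
    quadLaplace μ θ v ≤ A * N * θ ^ 2 * (∑ i, v i ^ 2) ^ 2 := by
  have h := sum_upper_triangle (fun i j => v i ^ 2 * v j ^ 2) fun i j => mul_comm _ _
  rw [sq (∑ i, v i ^ 2), Finset.sum_mul_sum, ← h, Finset.mul_sum]
  refine Finset.sum_le_sum fun p _ => (hμ.logLaplace_le _).trans_eq ?_
  unfold entryCoeff
  split_ifs with hp
  · have h3 : Real.sqrt (2 * N) ^ 2 = 2 * N := Real.sq_sqrt (by positivity)
    linear_combination (A / 2 * θ ^ 2 * (v p.1.1 * v p.1.2) ^ 2) * h3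
  · have h3 : Real.sqrt N ^ 2 = N := Real.sq_sqrt (by positivity)
    linear_combination (2 * A * θ ^ 2 * (v p.1.1 * v p.1.2) ^ 2) * h3

/-- If the coordinates of `v` in `S` are so large that the off-diagonal coefficients with indices
in `S` exceed `x`, then only these entries are kept; the others contribute nonnegatively. -/
theorem le_quadLaplace (hμ : SubGaussianEntries μ A B) {θ s x : ℝ} (hθ : 0 ≤ θ) (hs : 0 ≤ s)
    (hx : 0 ≤ x) (hsx : x ≤ 2 * θ * Real.sqrt N * s ^ 2) (S : Finset (Fin N)) (v : Fin N → ℝ)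
    (hv : ∀ i ∈ S, s ≤ v i) :
    (S.card * (S.card - 1) / 2 : ℝ) * logLaplace μ x ≤ quadLaplace μ θ v := by
  classical
  have h := sum_upper_triangle
    (fun i j => if i ∈ S ∧ j ∈ S ∧ i ≠ j then logLaplace μ x / 2 else 0)
    fun i j => by simp only [and_left_comm, ne_comm (a := i)]
  have hcount : ∑ i, ∑ j, (if i ∈ S ∧ j ∈ S ∧ i ≠ j then logLaplace μ x / 2 else 0) =
      (S.card * (S.card - 1) / 2 : ℝ) * logLaplace μ x := by
    have h1 : ∑ i, ∑ j, (if i ∈ S ∧ j ∈ S ∧ i ≠ j then logLaplace μ x / 2 else 0) =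
        ∑ p ∈ S.offDiag, logLaplace μ x / 2 := by
      rw [← Finset.sum_product', ← Finset.sum_filter]
      refine Finset.sum_congr ?_ fun _ _ => rfl
      ext p
      simp [Finset.mem_offDiag]
    rw [h1, Finset.sum_const, Finset.offDiag_card, nsmul_eq_mul,
      Nat.cast_sub (Nat.le_mul_self _)]
    push_cast
    ring
  rw [← hcount, ← h]
  refine Finset.sum_le_sum fun p _ => ?_
  by_cases hp : p.1.1 ∈ S ∧ p.1.2 ∈ S ∧ p.1.1 ≠ p.1.2
  · rw [if_neg hp.2.2, if_pos hp, entryCoeff, if_neg hp.2.2, mul_div_cancel₀ _ two_ne_zero]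
    refine hμ.logLaplace_le_logLaplace ?_
    rw [abs_of_nonneg hx]
    refine le_trans (hsx.trans ?_) (le_abs_self _)
    refine mul_le_mul_of_nonneg_left ?_ (by positivity)
    rw [sq]
    exact mul_le_mul (hv _ hp.1) (hv _ hp.2.1) hs (hs.trans (hv _ hp.1))
  · rw [if_neg hp, mul_zero]
    exact hμ.logLaplace_nonneg _

/-! ### The uniform measure on the sphere -/

theorem isProbabilityMeasure_uniformSphere (hN : 0 < N) :
    IsProbabilityMeasure (uniformSphere N) := by
  have : Nontrivial (EuclideanSpace ℝ (Fin N)) := by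
    have : Nonempty (Fin N) := ⟨⟨0, hN⟩⟩
    infer_instance
  refine ⟨?_⟩
  rw [uniformSphere, Measure.smul_apply, smul_eq_mul]
  refine ENNReal.inv_mul_cancel ?_ (measure_ne_top _ _)
  rw [Measure.measure_univ_ne_zero]
  exact Measure.toSphere_ne_zero _

/-- Fubini's theorem: the average over the matrix may be taken first. -/
theorem integral_sphericalIntegral [IsProbabilityMeasure P] (hμ : SubGaussianEntries μ A B)
    (hN : 0 < N) (hX : IsWigner μ P N X) (θ : ℝ) :
    Integrable (fun e => Real.exp (quadLaplace μ θ (e.1.ofLp))) (uniformSphere N) ∧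
    ∫ ω, sphericalIntegral (X ω) θ ∂P =
      ∫ e, Real.exp (quadLaplace μ θ (e.1.ofLp)) ∂(uniformSphere N) := by
  have := isProbabilityMeasure_uniformSphere hN
  have hmeas : AEStronglyMeasurable (Function.uncurry fun ω
      (e : Metric.sphere (0 : EuclideanSpace ℝ (Fin N)) 1) =>
      Real.exp (θ * N * (e.1.ofLp ⬝ᵥ (X ω).mulVec e.1.ofLp))) (P.prod (uniformSphere N)) := by
    refine AEMeasurable.aestronglyMeasurable ?_
    simp only [Function.uncurry_def, dotProduct, Matrix.mulVec]
    have h1 : ∀ i j, AEMeasurable (fun z : Ω × Metric.sphere (0 : EuclideanSpace ℝ (Fin N)) 1 =>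
        X z.1 i j) (P.prod (uniformSphere N)) := fun i j => (hX.aemeasurable i j).comp_fst
    have h2 : ∀ i, AEMeasurable (fun z : Ω × Metric.sphere (0 : EuclideanSpace ℝ (Fin N)) 1 =>
        z.2.1.ofLp i) (P.prod (uniformSphere N)) := fun i => by
      refine Measurable.aemeasurable ?_
      fun_prop
    refine (AEMeasurable.const_mul ?_ _).exp
    refine Finset.aemeasurable_fun_sum _ fun i _ => (h2 i).mul ?_
    exact Finset.aemeasurable_fun_sum _ fun j _ => (h1 i j).mul (h2 j)
  have hE : ∀ e : Metric.sphere (0 : EuclideanSpace ℝ (Fin N)) 1,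
      ∫ ω, Real.exp (θ * N * (e.1.ofLp ⬝ᵥ (X ω).mulVec e.1.ofLp)) ∂P =
      Real.exp (quadLaplace μ θ (e.1.ofLp)) := fun e => integral_exp_quadForm hμ hX θ _
  have hint : Integrable (fun e : Metric.sphere (0 : EuclideanSpace ℝ (Fin N)) 1 =>
      Real.exp (quadLaplace μ θ (e.1.ofLp))) (uniformSphere N) := by
    refine Integrable.of_bound (C := Real.exp (A * N * θ ^ 2)) ?_ ?_
    · have := hmeas.prod_swap.integral_prod_right'
      refine this.congr (ae_of_all _ fun e => ?_)
      exact hE e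
    · refine ae_of_all _ fun e => ?_
      rw [Real.norm_of_nonneg (Real.exp_pos _).le, Real.exp_le_exp]
      refine (quadLaplace_le hμ θ _).trans_eq ?_
      have h1 : ∑ i, e.1.ofLp i ^ 2 = 1 := by
        rw [← EuclideanSpace.real_norm_sq_eq, norm_eq_of_mem_sphere]; norm_num
      rw [h1]; ring
  refine ⟨hint, ?_⟩
  have hprod : Integrable (Function.uncurry fun ω
      (e : Metric.sphere (0 : EuclideanSpace ℝ (Fin N)) 1) =>
      Real.exp (θ * N * (e.1.ofLp ⬝ᵥ (X ω).mulVec e.1.ofLp))) (P.prod (uniformSphere N)) := by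
    rw [integrable_prod_iff' hmeas]
    refine ⟨ae_of_all _ fun e => ?_, ?_⟩
    · -- a function that is not integrable would have integral zero
      refine Integrable.of_integral_ne_zero ?_
      simp only [Function.uncurry]
      rw [hE e]
      exact (Real.exp_pos _).ne'
    · simp only [Function.uncurry, Real.norm_eq_abs, Real.abs_exp, hE]
      exact hint
  unfold sphericalIntegral
  rw [integral_integral_swap hprod]
  simp only [hE]

end

section

variable {N : ℕ}

/-- This follows from `e^{-N/2} 1_{‖x‖ < 1} ≤ e^{-N ‖x‖² / 2}`, and the Gaussian integral is
explicit. -/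
theorem volume_real_ball_le (hN : 0 < N) :
    (volume : Measure (EuclideanSpace ℝ (Fin N))).real (Metric.ball 0 1) ≤
      Real.sqrt (2 * Real.pi * Real.exp 1 / N) ^ N := by
  have hN' : (0 : ℝ) < N := by exact_mod_cast hN
  have hG := GaussianFourier.integral_rexp_neg_mul_sq_norm
    (V := EuclideanSpace ℝ (Fin N)) (b := N / 2) (by positivity)
  have hint : Integrable (fun v : EuclideanSpace ℝ (Fin N) => Real.exp (-(N / 2) * ‖v‖ ^ 2)) := by
    refine Integrable.of_integral_ne_zero ?_
    rw [hG]; positivity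
  have h1 : (volume : Measure (EuclideanSpace ℝ (Fin N))).real (Metric.ball 0 1) *
      Real.exp (-(N / 2)) ≤ ∫ v : EuclideanSpace ℝ (Fin N), Real.exp (-(N / 2) * ‖v‖ ^ 2) := by
    have h2 : ∫ v in Metric.ball (0 : EuclideanSpace ℝ (Fin N)) 1, Real.exp (-(N / 2 : ℝ)) ≤
        ∫ v in Metric.ball (0 : EuclideanSpace ℝ (Fin N)) 1, Real.exp (-(N / 2) * ‖v‖ ^ 2) := by
      refine setIntegral_mono_on (integrableOn_const measure_ball_lt_top.ne) hint.integrableOn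
        measurableSet_ball fun v hv => ?_
      rw [Real.exp_le_exp]
      have : ‖v‖ < 1 := by simpa using hv
      have : ‖v‖ ^ 2 ≤ 1 := by nlinarith [norm_nonneg v]
      nlinarith
    rw [setIntegral_const, smul_eq_mul] at h2
    exact h2.trans (setIntegral_le_integral hint (ae_of_all _ fun _ => (Real.exp_pos _).le))
  rw [hG, finrank_euclideanSpace_fin] at h1
  have h3 : (Real.pi / (N / 2)) ^ ((N : ℝ) / 2) * Real.exp (N / 2) =
      Real.sqrt (2 * Real.pi * Real.exp 1 / N) ^ N := by
    rw [← Real.rpow_natCast, Real.sqrt_eq_rpow, ← Real.rpow_mul (by positivity),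
      show 2 * Real.pi * Real.exp 1 / N = Real.pi / (N / 2) * Real.exp 1 by field_simp,
      Real.mul_rpow (by positivity) (by positivity), ← Real.exp_mul]
    congr 2 <;> ring
  rw [← h3]
  calc _ = (volume : Measure (EuclideanSpace ℝ (Fin N))).real (Metric.ball 0 1) *
      Real.exp (-(N / 2)) * Real.exp (N / 2) := by
        rw [mul_assoc, ← Real.exp_add]; simp
    _ ≤ _ := mul_le_mul_of_nonneg_right h1 (Real.exp_pos _).le

/-- The box with sides `[s, (1 + δ) s]` in the directions of `S` and `[-√(δ/N), √(δ/N)]` in the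
other directions. -/
def spikeBox (S : Finset (Fin N)) (s δ : ℝ) : Set (EuclideanSpace ℝ (Fin N)) :=
  (WithLp.ofLp) ⁻¹' Set.univ.pi fun i =>
    if i ∈ S then Set.Icc s ((1 + δ) * s) else Set.Icc (-Real.sqrt (δ / N)) (Real.sqrt (δ / N))

theorem le_volume_real_spikeBox (S : Finset (Fin N)) {s δ : ℝ}
    (hside : 2 * Real.sqrt (δ / N) ≤ δ * s) :
    (2 * Real.sqrt (δ / N)) ^ N ≤ volume.real (spikeBox S s δ) := by
  rw [measureReal_def, spikeBox, (PiLp.volume_preserving_ofLp (Fin N)).measure_preimage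
    (MeasurableSet.univ_pi fun i => by split_ifs <;> exact measurableSet_Icc).nullMeasurableSet,
    volume_pi_pi, ENNReal.toReal_prod]
  have h : ∀ i ∈ (Finset.univ : Finset (Fin N)), 2 * Real.sqrt (δ / N) ≤
      (volume (if i ∈ S then Set.Icc s ((1 + δ) * s)
        else Set.Icc (-Real.sqrt (δ / N)) (Real.sqrt (δ / N)))).toReal := by
    intro i _
    split_ifs
    all_goals
      rw [Real.volume_Icc, ENNReal.toReal_ofReal']
      exact le_max_of_le_left (by linarith)
  simpa using Finset.prod_le_prod (fun _ _ => by positivity) h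

theorem norm_lt_one_of_mem_spikeBox (hN : 0 < N) {S : Finset (Fin N)} {s δ : ℝ} (hs : 0 ≤ s)
    (hδ : 0 < δ) (hnorm : S.card * ((1 + δ) * s) ^ 2 + δ < 1)
    {x : EuclideanSpace ℝ (Fin N)} (hx : x ∈ spikeBox S s δ) : ‖x‖ < 1 := by
  have hN' : (0 : ℝ) < N := by exact_mod_cast hN
  have hle : ∀ i, x i ^ 2 ≤ (if i ∈ S then ((1 + δ) * s) ^ 2 else 0) + δ / N := by
    intro i
    have hi := hx i (Set.mem_univ i)
    by_cases h : i ∈ S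
    · simp only [if_pos h] at hi ⊢
      have : x i ^ 2 ≤ ((1 + δ) * s) ^ 2 := pow_le_pow_left₀ (hs.trans hi.1) hi.2 2
      have : 0 ≤ δ / N := by positivity
      linarith
    · simp only [if_neg h] at hi ⊢
      have : x i ^ 2 ≤ Real.sqrt (δ / N) ^ 2 := sq_le_sq' hi.1 hi.2
      rw [Real.sq_sqrt (by positivity)] at this
      linarith
  have h1 : ‖x‖ ^ 2 < 1 := by
    rw [EuclideanSpace.real_norm_sq_eq]
    refine (Finset.sum_le_sum fun i _ => hle i).trans_lt ?_
    rw [Finset.sum_add_distrib, Finset.sum_ite_mem, Finset.univ_inter, Finset.sum_const,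
      Finset.sum_const, Finset.card_univ, Fintype.card_fin, nsmul_eq_mul, nsmul_eq_mul,
      mul_div_cancel₀ _ hN'.ne']
    exact hnorm
  nlinarith [norm_nonneg x]

/-- The unit vectors whose coordinates in `S` are at least `s`. -/
def spikes (S : Finset (Fin N)) (s : ℝ) : Set (Metric.sphere (0 : EuclideanSpace ℝ (Fin N)) 1) :=
  {e | ∀ i ∈ S, s ≤ e.1.ofLp i}

theorem measurableSet_spikes (S : Finset (Fin N)) (s : ℝ) : MeasurableSet (spikes S s) := by
  have h : ∀ i, Measurable fun e : Metric.sphere (0 : EuclideanSpace ℝ (Fin N)) 1 =>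
      e.1.ofLp i := fun i => by fun_prop
  simp only [spikes, Set.ofPred_forall]
  exact Finset.measurableSet_biInter _ fun i _ => measurableSet_le measurable_const (h i)

theorem spikeBox_subset_cone (hN : 0 < N) {S : Finset (Fin N)} {s δ : ℝ} (hs : 0 ≤ s)
    (hδ : 0 < δ) (hnorm : S.card * ((1 + δ) * s) ^ 2 + δ < 1) :
    spikeBox S s δ \ {0} ⊆ Set.Ioo (0 : ℝ) 1 • (Subtype.val '' spikes S s) := by
  rintro x ⟨hx, hx0⟩
  have hlt := norm_lt_one_of_mem_spikeBox hN hs hδ hnorm hx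
  have hpos : 0 < ‖x‖ := norm_pos_iff.2 hx0
  have hmem : ‖x‖⁻¹ • x ∈ Metric.sphere (0 : EuclideanSpace ℝ (Fin N)) 1 := by
    rw [mem_sphere_zero_iff_norm, norm_smul, norm_inv, norm_norm, inv_mul_cancel₀ hpos.ne']
  refine Set.mem_smul.2 ⟨‖x‖, ⟨hpos, hlt⟩, ‖x‖⁻¹ • x, ⟨⟨_, hmem⟩, fun i hi => ?_, rfl⟩, ?_⟩
  · have hxi := hx i (Set.mem_univ i)
    simp only [if_pos hi] at hxi
    have h1 : 1 ≤ ‖x‖⁻¹ := (one_le_inv₀ hpos).2 hlt.le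
    change s ≤ ‖x‖⁻¹ * x i
    nlinarith [hxi.1]
  · rw [smul_smul, mul_inv_cancel₀ hpos.ne', one_smul]

/-- With probability at least `κ^N`, `κ` depending only on `δ`, all coordinates in `S` of a
uniform unit vector are at least `s`. -/
theorem le_uniformSphere_real_spikes (hN : 0 < N) {S : Finset (Fin N)} {s δ : ℝ} (hs : 0 ≤ s)
    (hδ : 0 < δ) (hnorm : S.card * ((1 + δ) * s) ^ 2 + δ < 1)
    (hside : 2 * Real.sqrt (δ / N) ≤ δ * s) :
    (2 * Real.sqrt δ / Real.sqrt (2 * Real.pi * Real.exp 1)) ^ N ≤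
      (uniformSphere N).real (spikes S s) := by
  have hN' : (0 : ℝ) < N := by exact_mod_cast hN
  have : Nontrivial (EuclideanSpace ℝ (Fin N)) := by
    have : Nonempty (Fin N) := ⟨⟨0, hN⟩⟩
    infer_instance
  set T := spikes S s
  set V := (volume : Measure (EuclideanSpace ℝ (Fin N)))
  have hball : 0 < V.real (Metric.ball 0 1) :=
    ENNReal.toReal_pos (Metric.measure_ball_pos _ _ one_pos).ne' measure_ball_lt_top.ne
  have hcone : Set.Ioo (0 : ℝ) 1 • (Subtype.val '' T) ⊆ Metric.ball 0 1 := by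
    rintro _ ⟨r, hr, _, ⟨e, -, rfl⟩, rfl⟩
    simp only [mem_ball_zero_iff, norm_smul, norm_eq_of_mem_sphere, mul_one, Real.norm_eq_abs]
    rw [abs_of_pos hr.1]; exact hr.2
  have heq : (uniformSphere N).real T = V.real (Set.Ioo (0 : ℝ) 1 • (Subtype.val '' T)) /
      V.real (Metric.ball 0 1) := by
    rw [uniformSphere, measureReal_def, Measure.smul_apply, Measure.toSphere_apply_univ,
      Measure.toSphere_apply' _ (measurableSet_spikes S s), finrank_euclideanSpace_fin]
    simp only [smul_eq_mul, ENNReal.toReal_mul, ENNReal.toReal_inv, ENNReal.toReal_natCast]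
    change (N * V.real (Metric.ball 0 1))⁻¹ *
      (N * V.real (Set.Ioo (0 : ℝ) 1 • (Subtype.val '' T))) = _
    field_simp
  have hbox : V.real (spikeBox S s δ) ≤ V.real (Set.Ioo (0 : ℝ) 1 • (Subtype.val '' T)) := by
    have h1 : V (spikeBox S s δ \ {0}) = V (spikeBox S s δ) :=
      measure_sdiff_null (measure_singleton _)
    rw [measureReal_def, ← h1]
    exact measureReal_mono (spikeBox_subset_cone hN hs hδ hnorm)
      ((measure_mono hcone).trans_lt measure_ball_lt_top).ne
  rw [heq, le_div_iff₀ hball]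
  refine le_trans ?_ ((le_volume_real_spikeBox S hside).trans hbox)
  refine (mul_le_mul_of_nonneg_left (volume_real_ball_le hN) (by positivity)).trans_eq ?_
  rw [← mul_pow]
  congr 1
  rw [Real.sqrt_div (by positivity), Real.sqrt_div hδ.le]
  have : Real.sqrt (2 * Real.pi * Real.exp 1) ≠ 0 := by positivity
  have : Real.sqrt N ≠ 0 := by positivity
  field_simp

end

/-! ### The annealed spherical integral -/

section

variable {μ : Measure ℝ} [IsProbabilityMeasure μ] {A B : ℝ}
  {Ω : Type*} [MeasurableSpace Ω] {P : Measure Ω} [IsProbabilityMeasure P] {N : ℕ}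
  {X : Ω → Matrix (Fin N) (Fin N) ℝ}

theorem annealed_nonneg (hμ : SubGaussianEntries μ A B) (hN : 0 < N)
    (hX : IsWigner μ P N X) (θ : ℝ) : 0 ≤ annealed P X θ := by
  have := isProbabilityMeasure_uniformSphere hN
  obtain ⟨hint, heq⟩ := integral_sphericalIntegral hμ hN hX θ
  have h1 := integral_mono (integrable_const (1 : ℝ)) hint
    fun e => Real.one_le_exp (quadLaplace_nonneg hμ θ _)
  rw [annealed, heq]
  refine mul_nonneg (by positivity) (Real.log_nonneg ?_)
  simpa using h1

theorem annealed_le (hμ : SubGaussianEntries μ A B) (hN : 0 < N)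
    (hX : IsWigner μ P N X) (θ : ℝ) : annealed P X θ ≤ A * θ ^ 2 := by
  have := isProbabilityMeasure_uniformSphere hN
  have hN' : (0 : ℝ) < N := by exact_mod_cast hN
  obtain ⟨hint, heq⟩ := integral_sphericalIntegral hμ hN hX θ
  have h1 : ∫ e, Real.exp (quadLaplace μ θ (e.1.ofLp)) ∂(uniformSphere N) ≤
      Real.exp (A * N * θ ^ 2) := by
    have := integral_mono hint (integrable_const (Real.exp (A * N * θ ^ 2))) fun e => by
      refine Real.exp_le_exp.2 ((quadLaplace_le hμ θ _).trans_eq ?_)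
      rw [← EuclideanSpace.real_norm_sq_eq, norm_eq_of_mem_sphere]; ring
    simpa using this
  have h2 : 0 < ∫ e, Real.exp (quadLaplace μ θ (e.1.ofLp)) ∂(uniformSphere N) :=
    integral_exp_pos hint
  rw [annealed, heq, one_div, inv_mul_le_iff₀ hN']
  refine (Real.log_le_log h2 h1).trans_eq ?_
  rw [Real.log_exp]; ring

/-- Restricting the average over the sphere to vectors with many large coordinates. -/
theorem le_annealed (hμ : SubGaussianEntries μ A B) (hN : 0 < N)
    (hX : IsWigner μ P N X) {θ s x δ : ℝ} (hθ : 0 ≤ θ) (hs : 0 ≤ s) (hx : 0 ≤ x) (hδ : 0 < δ)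
    (hsx : x ≤ 2 * θ * Real.sqrt N * s ^ 2) (S : Finset (Fin N))
    (hnorm : S.card * ((1 + δ) * s) ^ 2 + δ < 1) (hside : 2 * Real.sqrt (δ / N) ≤ δ * s) :
    Real.log (2 * Real.sqrt δ / Real.sqrt (2 * Real.pi * Real.exp 1)) +
      S.card * (S.card - 1) / (2 * N) * logLaplace μ x ≤ annealed P X θ := by
  have := isProbabilityMeasure_uniformSphere hN
  have hN' : (0 : ℝ) < N := by exact_mod_cast hN
  obtain ⟨hint, heq⟩ := integral_sphericalIntegral hμ hN hX θ
  set κ := 2 * Real.sqrt δ / Real.sqrt (2 * Real.pi * Real.exp 1) with hκ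
  have hκ0 : 0 < κ := by positivity
  set q := (S.card * (S.card - 1) / 2 : ℝ) * logLaplace μ x with hq
  have h1 : κ ^ N * Real.exp q ≤
      ∫ e, Real.exp (quadLaplace μ θ (e.1.ofLp)) ∂(uniformSphere N) := by
    refine (mul_le_mul_of_nonneg_right (le_uniformSphere_real_spikes hN hs hδ hnorm hside)
      (Real.exp_pos _).le).trans ?_
    rw [← smul_eq_mul, ← setIntegral_const]
    refine le_trans ?_ (setIntegral_le_integral (s := spikes S s) hint
      (ae_of_all _ fun _ => (Real.exp_pos _).le))
    refine setIntegral_mono_on (integrableOn_const (measure_ne_top _ _)) hint.integrableOn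
      (measurableSet_spikes S s) fun e he => Real.exp_le_exp.2 ?_
    exact le_quadLaplace hμ hθ hs hx hsx S _ he
  rw [annealed, heq, one_div, le_inv_mul_iff₀ hN']
  refine le_trans (le_of_eq ?_) (Real.log_le_log (by positivity) h1)
  rw [Real.log_mul (by positivity) (by positivity), Real.log_exp, Real.log_pow, hq]
  field_simp

end

section

variable {μ : Measure ℝ} [IsProbabilityMeasure μ] {A B : ℝ}
  {Ω : ℕ → Type*} [∀ N, MeasurableSpace (Ω N)] {P : ∀ N, Measure (Ω N)}
  [∀ N, IsProbabilityMeasure (P N)] {X : ∀ N, Ω N → Matrix (Fin N) (Fin N) ℝ}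

theorem annealedLimsup_nonneg (hμ : SubGaussianEntries μ A B)
    (hX : ∀ N, IsWigner μ (P N) N (X N)) (θ : ℝ) : 0 ≤ annealedLimsup P X θ := by
  refine le_limsup_of_frequently_le (Eventually.frequently ?_)
  filter_upwards [eventually_gt_atTop 0] with N hN
  exact_mod_cast annealed_nonneg hμ hN (hX N) θ

theorem annealedLimsup_le (hμ : SubGaussianEntries μ A B)
    (hX : ∀ N, IsWigner μ (P N) N (X N)) (θ : ℝ) :
    annealedLimsup P X θ ≤ ((A * θ ^ 2 : ℝ) : EReal) := by
  refine limsup_le_of_le (by isBoundedDefault) ?_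
  filter_upwards [eventually_gt_atTop 0] with N hN
  exact EReal.coe_le_coe (annealed_le hμ hN (hX N) θ)

/-- Localizing the vector on order `√N` coordinates costs the logarithm on the left, which does
not depend on `θ`; the factor `(1 - 4δ)²` is lost because these coordinates carry only the
proportion `1 - 4δ` of the mass. -/
theorem le_annealedLimsup (hμ : SubGaussianEntries μ A B)
    (hX : ∀ N, IsWigner μ (P N) N (X N)) {θ x δ a : ℝ} (hθ : 0 < θ) (hx : 0 < x) (hδ : 0 < δ)
    (hδ4 : δ < 1 / 4) (hax : a / 2 * x ^ 2 ≤ logLaplace μ x) :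
    ((a * (1 - 4 * δ) ^ 2 * θ ^ 2 +
      Real.log (2 * Real.sqrt δ / Real.sqrt (2 * Real.pi * Real.exp 1)) : ℝ) : EReal) ≤
      annealedLimsup P X θ := by
  set κ := 2 * Real.sqrt δ / Real.sqrt (2 * Real.pi * Real.exp 1) with hκ
  set β := 2 * (1 - 4 * δ) * θ / x with hβ
  have hβ0 : 0 < β := by
    have : 0 < 1 - 4 * δ := by linarith
    positivity
  have hsqrt : Tendsto (fun N : ℕ => Real.sqrt N) atTop atTop :=
    Real.tendsto_sqrt_atTop.comp tendsto_natCast_atTop_atTop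
  have hinv : Tendsto (fun N : ℕ => (Real.sqrt N)⁻¹) atTop (𝓝 0) := hsqrt.inv_tendsto_atTop
  have hlim : Tendsto (fun N : ℕ => Real.log κ +
      (β - (Real.sqrt N)⁻¹) * (β - 2 * (Real.sqrt N)⁻¹) / 2 * logLaplace μ x) atTop
      (𝓝 (Real.log κ + β ^ 2 / 2 * logLaplace μ x)) := by
    have h1 : Tendsto (fun N : ℕ => Real.log κ +
      (β - (Real.sqrt N)⁻¹) * (β - 2 * (Real.sqrt N)⁻¹) / 2 * logLaplace μ x) atTop
      (𝓝 (Real.log κ + (β - 0) * (β - 2 * 0) / 2 * logLaplace μ x)) :=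
      tendsto_const_nhds.add ((((tendsto_const_nhds.sub hinv).mul
        (tendsto_const_nhds.sub (hinv.const_mul 2))).div_const 2).mul_const _)
    convert h1 using 2
    ring
  have hev : ∀ᶠ N : ℕ in atTop, Real.log κ +
      (β - (Real.sqrt N)⁻¹) * (β - 2 * (Real.sqrt N)⁻¹) / 2 * logLaplace μ x ≤
      annealed (P N) (X N) θ := by
    filter_upwards [eventually_gt_atTop 0, hsqrt.eventually_ge_atTop β,
      hsqrt.eventually_ge_atTop (2 / β), hsqrt.eventually_ge_atTop (8 * θ / (δ * x))]
      with N hN hNβ hN2 hNδ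
    have hN' : (0 : ℝ) < N := by exact_mod_cast hN
    set r := Real.sqrt N with hr
    have hr0 : 0 < r := Real.sqrt_pos.2 hN'
    have hrN : r ^ 2 = N := Real.sq_sqrt hN'.le
    rw [div_le_iff₀ hβ0] at hN2
    set k := ⌊β * r⌋₊ with hk
    have hkle : (k : ℝ) ≤ β * r := Nat.floor_le (by positivity)
    have hklt : β * r < k + 1 := Nat.lt_floor_add_one _
    have hkN : k ≤ N := by
      have : (k : ℝ) ≤ N := by rw [← hrN]; nlinarith
      exact_mod_cast this
    -- with this `s` the off-diagonal coefficients `2θ√N v i v j` are at least `x`, and `k` is the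
    -- largest integer with `k s² ≤ 1 - 4δ`
    set s := Real.sqrt (x / (2 * θ * r)) with hs
    have hs2 : s ^ 2 = x / (2 * θ * r) := Real.sq_sqrt (by positivity)
    set S : Finset (Fin N) := Finset.univ.filter fun i => i.val < k with hS
    have hcard : S.card = k := by
      rw [hS, Fin.card_filter_val_lt, min_eq_right hkN]
    have hks : k * s ^ 2 ≤ 1 - 4 * δ := by
      rw [hs2]
      refine (mul_le_mul_of_nonneg_right hkle (by positivity)).trans_eq ?_
      rw [hβ]; field_simp
    have hnorm : S.card * ((1 + δ) * s) ^ 2 + δ < 1 := by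
      rw [hcard, mul_pow, mul_left_comm]
      -- `(1 + δ)² (1 - 4δ) + δ = 1 - δ - 7δ² - 4δ³ < 1`
      have h1 : (1 + δ) ^ 2 * (k * s ^ 2) ≤ (1 + δ) ^ 2 * (1 - 4 * δ) :=
        mul_le_mul_of_nonneg_left hks (by positivity)
      nlinarith [pow_pos hδ 3, pow_pos hδ 2]
    have hside : 2 * Real.sqrt (δ / N) ≤ δ * s := by
      have h1 : 2 * Real.sqrt (δ / N) = Real.sqrt (4 * (δ / N)) := by
        rw [Real.sqrt_mul (by norm_num), show (4 : ℝ) = 2 ^ 2 by norm_num,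
          Real.sqrt_sq (by norm_num)]
      have h2 : δ * s = Real.sqrt (δ ^ 2 * (x / (2 * θ * r))) := by
        rw [Real.sqrt_mul (by positivity), Real.sqrt_sq hδ.le]
      rw [h1, h2]
      refine Real.sqrt_le_sqrt ?_
      rw [div_le_iff₀ (by positivity)] at hNδ
      rw [← hrN, mul_div_assoc', mul_div_assoc', div_le_div_iff₀ (by positivity) (by positivity)]
      have h3 : 0 ≤ δ * r * (r * (δ * x) - 8 * θ) :=
        mul_nonneg (by positivity) (by linarith)
      nlinarith
    have hsx : x ≤ 2 * θ * Real.sqrt N * s ^ 2 := by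
      rw [hs2, ← hr]; apply le_of_eq; field_simp
    refine le_trans ?_ (le_annealed hμ hN (hX N) hθ.le (Real.sqrt_nonneg _) hx.le hδ hsx S hnorm
      hside)
    rw [hcard]
    refine add_le_add le_rfl (mul_le_mul_of_nonneg_right ?_ (hμ.logLaplace_nonneg _))
    have h1 : (β - r⁻¹) * (β - 2 * r⁻¹) / 2 = (β * r - 1) * (β * r - 2) / (2 * N) := by
      rw [← hrN]; field_simp
    rw [h1]
    refine div_le_div_of_nonneg_right ?_ (by positivity)
    nlinarith
  have h1 : ((Real.log κ + β ^ 2 / 2 * logLaplace μ x : ℝ) : EReal) ≤ annealedLimsup P X θ := by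
    rw [← ((continuous_coe_real_ereal.tendsto _).comp hlim).limsup_eq]
    refine limsup_le_limsup ?_ (by isBoundedDefault) (by isBoundedDefault)
    filter_upwards [hev] with N hN
    exact EReal.coe_le_coe hN
  refine le_trans (EReal.coe_le_coe ?_) h1
  have h2 : β ^ 2 / 2 * (a / 2 * x ^ 2) ≤ β ^ 2 / 2 * logLaplace μ x :=
    mul_le_mul_of_nonneg_left hax (by positivity)
  have h3 : β ^ 2 / 2 * (a / 2 * x ^ 2) = a * (1 - 4 * δ) ^ 2 * θ ^ 2 := by
    rw [hβ]; field_simp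
  linarith

/-- The growth `F̄(θ) ~ A θ²` from below. -/
theorem exists_le_annealedLimsup (hμ : SubGaussianEntries μ A B)
    (hX : ∀ N, IsWigner μ (P N) N (X N)) {a : ℝ} (ha : 0 < a) (haA : a < A) :
    ∃ C : ℝ, ∀ θ, 0 ≤ θ → ((a * θ ^ 2 - C : ℝ) : EReal) ≤ annealedLimsup P X θ := by
  obtain ⟨b, hab, hbA⟩ := exists_between haA
  have hb : 0 < b := ha.trans hab
  obtain ⟨x, hx, hbx⟩ := hμ.exists_lt_logLaplace hbA
  set δ := min (1 / 5) ((b - a) / (8 * b)) with hδ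
  have hδ0 : 0 < δ := lt_min (by norm_num) (div_pos (by linarith) (by positivity))
  have hδ5 : δ ≤ 1 / 5 := min_le_left _ _
  have hδb : δ * (8 * b) ≤ b - a := by
    rw [← le_div_iff₀ (by positivity)]; exact min_le_right _ _
  set l := Real.log (2 * Real.sqrt δ / Real.sqrt (2 * Real.pi * Real.exp 1)) with hl
  refine ⟨max 0 (-l), fun θ hθ => ?_⟩
  rcases hθ.eq_or_lt with rfl | hθ
  · refine le_trans ?_ (annealedLimsup_nonneg hμ hX 0)
    rw [← EReal.coe_zero, EReal.coe_le_coe_iff]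
    linarith [le_max_left 0 (-l)]
  · refine le_trans (EReal.coe_le_coe ?_)
      (le_annealedLimsup hμ hX hθ hx hδ0 (by linarith) hbx)
    have h1 : a ≤ b * (1 - 4 * δ) ^ 2 := by nlinarith [mul_pos hb (pow_pos hδ0 2)]
    have h2 := mul_le_mul_of_nonneg_right h1 (sq_nonneg θ)
    linarith [le_max_right 0 (-l)]

end

/-! ### The rate function -/

section

variable {μ : Measure ℝ} [IsProbabilityMeasure μ] {A B : ℝ}
  {Ω : ℕ → Type*} [∀ N, MeasurableSpace (Ω N)] {P : ∀ N, Measure (Ω N)}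
  [∀ N, IsProbabilityMeasure (P N)] {X : ∀ N, Ω N → Matrix (Fin N) (Fin N) ℝ}

theorem coe_toReal_annealedLimsup (hμ : SubGaussianEntries μ A B)
    (hX : ∀ N, IsWigner μ (P N) N (X N)) (θ : ℝ) :
    ((annealedLimsup P X θ).toReal : EReal) = annealedLimsup P X θ :=
  EReal.coe_toReal ((annealedLimsup_le hμ hX θ).trans_lt (EReal.coe_lt_top _)).ne
    ((EReal.bot_lt_coe 0).trans_le (annealedLimsup_nonneg hμ hX θ)).ne'

theorem upperRate_of_two_le (hμ : SubGaussianEntries μ A B)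
    (hX : ∀ N, IsWigner μ (P N) N (X N)) {x : ℝ} (hx : 2 ≤ x) :
    upperRate P X x = ⨆ θ : {θ : ℝ // 0 ≤ θ},
      ((sphericalLimit semicircle x θ.1 - (annealedLimsup P X θ.1).toReal : ℝ) : EReal) := by
  rw [upperRate, if_neg (not_lt.2 hx)]
  refine iSup_congr fun θ => ?_
  rw [EReal.coe_sub, coe_toReal_annealedLimsup hμ hX]

theorem upperRate_nonneg (hμ : SubGaussianEntries μ A B)
    (hX : ∀ N, IsWigner μ (P N) N (X N)) (x : ℝ) : 0 ≤ upperRate P X x := by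
  rcases lt_or_ge x 2 with hx | hx
  · simp [upperRate, hx]
  · rw [upperRate_of_two_le hμ hX hx]
    refine le_iSup_of_le ⟨0, le_rfl⟩ ?_
    have h : annealedLimsup P X 0 = 0 :=
      le_antisymm (by simpa using annealedLimsup_le hμ hX 0) (annealedLimsup_nonneg hμ hX 0)
    simp [sphericalLimit_zero, h]

theorem lowerSemicontinuous_upperRate (hμ : SubGaussianEntries μ A B)
    (hX : ∀ N, IsWigner μ (P N) N (X N)) : LowerSemicontinuous (upperRate P X) := by
  intro x y hy
  rcases lt_or_ge x 2 with hx | hx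
  · filter_upwards [gt_mem_nhds hx] with x' hx'
    rw [upperRate, if_pos hx] at hy
    rwa [upperRate, if_pos hx']
  · rw [upperRate_of_two_le hμ hX hx, gt_iff_lt, lt_iSup_iff] at hy
    obtain ⟨θ, hθ⟩ := hy
    have hc : ContinuousWithinAt (fun x => ((sphericalLimit semicircle x θ.1 -
        (annealedLimsup P X θ.1).toReal : ℝ) : EReal)) (Set.Ici 2) x :=
      continuous_coe_real_ereal.continuousAt.comp_continuousWithinAt
        ((continuousOn_sphericalLimit_semicircle θ.2 x hx).sub continuousWithinAt_const)
    filter_upwards [mem_nhdsWithin_iff_eventually.1 (hc.eventually (lt_mem_nhds hθ))] with x' hx'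
    rcases lt_or_ge x' 2 with h2 | h2
    · rw [upperRate, if_pos h2]
      exact hθ.trans_le le_top
    · rw [upperRate_of_two_le hμ hX h2]
      exact (hx' h2).trans_le (le_iSup (fun θ : {θ : ℝ // 0 ≤ θ} =>
        ((sphericalLimit semicircle x' θ.1 - (annealedLimsup P X θ.1).toReal : ℝ) : EReal)) θ)

/-- The choice `θ = x / (2A)`, which maximizes `θ x - A θ²`. -/
theorem le_upperRate (hμ : SubGaussianEntries μ A B)
    (hX : ∀ N, IsWigner μ (P N) N (X N)) {x : ℝ} (hx : 3 ≤ x) (hxA : A < x * (x - 2)) :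
    ((x ^ 2 / (4 * A) - 1 / 2 - 1 / 2 * Real.log (x / A * (x + 2)) : ℝ) : EReal) ≤
      upperRate P X x := by
  have hA : 0 < A := one_pos.trans hμ.one_lt
  rw [upperRate_of_two_le hμ hX (by linarith)]
  refine le_iSup_of_le ⟨x / (2 * A), div_nonneg (by linarith) (by linarith)⟩
    (EReal.coe_le_coe ?_)
  have h2θ : 2 * (x / (2 * A)) = x / A := by field_simp
  have h1 := le_sphericalLimit_semicircle (x := x) (θ := x / (2 * A)) (by linarith) (by
    rw [h2θ, div_mul_eq_mul_div, one_lt_div hA]; exact hxA)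
  have h2 : (annealedLimsup P X (x / (2 * A))).toReal ≤ A * (x / (2 * A)) ^ 2 := by
    rw [← EReal.coe_le_coe_iff, coe_toReal_annealedLimsup hμ hX]
    exact annealedLimsup_le hμ hX _
  rw [h2θ] at h1
  have h3 : x / (2 * A) * x - A * (x / (2 * A)) ^ 2 = x ^ 2 / (4 * A) := by field_simp; ring
  simp only
  linarith

theorem exists_upperRate_le (hμ : SubGaussianEntries μ A B)
    (hX : ∀ N, IsWigner μ (P N) N (X N)) {a : ℝ} (ha : 0 < a) (haA : a < A) :
    ∃ C : ℝ, ∀ x, 3 ≤ x → upperRate P X x ≤ ((x ^ 2 / (4 * a) + C : ℝ) : EReal) := by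
  obtain ⟨C, hC⟩ := exists_le_annealedLimsup hμ hX ha haA
  refine ⟨C + (3 + Real.log 5), fun x hx => ?_⟩
  rw [upperRate_of_two_le hμ hX (by linarith)]
  refine iSup_le fun θ => EReal.coe_le_coe ?_
  have h1 := sphericalLimit_semicircle_le hx θ.2
  have h2 : a * θ.1 ^ 2 - C ≤ (annealedLimsup P X θ.1).toReal := by
    rw [← EReal.coe_le_coe_iff, coe_toReal_annealedLimsup hμ hX]
    exact hC θ.1 θ.2
  have h3 : θ.1 * x - a * θ.1 ^ 2 ≤ x ^ 2 / (4 * a) := by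
    rw [le_div_iff₀ (by positivity)]
    nlinarith [sq_nonneg (x - 2 * a * θ.1)]
  linarith

theorem tendsto_upperRate_div_sq (hμ : SubGaussianEntries μ A B)
    (hX : ∀ N, IsWigner μ (P N) N (X N)) :
    Tendsto (fun x : ℝ => upperRate P X x / ((x ^ 2 : ℝ) : EReal)) atTop
      (𝓝 ((1 / (4 * A) : ℝ) : EReal)) := by
  have hA : 0 < A := one_pos.trans hμ.one_lt
  have hinv : Tendsto (fun x : ℝ => x⁻¹) atTop (𝓝 0) := tendsto_inv_atTop_zero
  rw [tendsto_order]
  constructor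
  · intro y hy
    have hlim : Tendsto (fun x : ℝ => (x ^ 2 / (4 * A) - 1 / 2 -
        1 / 2 * Real.log (x / A * (x + 2))) / x ^ 2) atTop (𝓝 (1 / (4 * A))) := by
      have hlog : Tendsto (fun x : ℝ => Real.log (x / A * (x + 2)) / x ^ 2) atTop (𝓝 0) := by
        -- compare with `log (u) / u`, where `u = (x / A) (x + 2)` has order `x²`
        have hu : Tendsto (fun x : ℝ => x / A * (x + 2)) atTop atTop :=
          (tendsto_id.atTop_div_const hA).atTop_mul_atTop₀
            (tendsto_atTop_add_const_right _ _ tendsto_id)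
        have h1 : Tendsto (fun u : ℝ => Real.log u / u) atTop (𝓝 0) := by
          simpa using Real.tendsto_pow_log_div_mul_add_atTop 1 0 1 one_ne_zero
        have h2 : Tendsto (fun x : ℝ => (1 + 2 * x⁻¹) / A) atTop (𝓝 ((1 + 2 * 0) / A)) :=
          (tendsto_const_nhds.add (hinv.const_mul 2)).div_const A
        have h3 := (h1.comp hu).mul h2
        rw [zero_mul] at h3
        refine h3.congr' ?_
        filter_upwards [eventually_gt_atTop 0] with x hx
        simp only [Function.comp]
        field_simp
      have h4 := (tendsto_const_nhds (x := 1 / (4 * A))).sub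
        (((hinv.mul hinv).const_mul (1 / 2)).add (hlog.const_mul (1 / 2)))
      simp only [mul_zero, add_zero, sub_zero] at h4
      refine h4.congr' ?_
      filter_upwards [eventually_gt_atTop 0] with x hx
      field_simp
      ring
    have hlim' := (continuous_coe_real_ereal.tendsto _).comp hlim
    have hquad : ∀ᶠ x : ℝ in atTop, A < x * (x - 2) := by
      filter_upwards [eventually_ge_atTop 3, eventually_gt_atTop A] with x hx hxA
      nlinarith
    filter_upwards [hlim'.eventually (lt_mem_nhds hy), eventually_ge_atTop 3, hquad]
      with x hx hx3 hxA
    refine hx.trans_le ?_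
    simp only [Function.comp, EReal.coe_div]
    exact EReal.div_le_div_right_of_nonneg (EReal.coe_nonneg.2 (sq_nonneg x))
      (le_upperRate hμ hX hx3 hxA)
  · intro y hy
    obtain ⟨a, ha, haA, hay⟩ : ∃ a, 0 < a ∧ a < A ∧ ((1 / (4 * a) : ℝ) : EReal) < y := by
      have hc : ContinuousAt (fun a : ℝ => ((1 / (4 * a) : ℝ) : EReal)) A :=
        continuous_coe_real_ereal.continuousAt.comp
          (by have : 4 * A ≠ 0 := by positivity
              fun_prop (disch := assumption))
      have h1 : ∀ᶠ a in 𝓝[<] A, ((1 / (4 * a) : ℝ) : EReal) < y :=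
        (hc.eventually (gt_mem_nhds hy)).filter_mono nhdsWithin_le_nhds
      obtain ⟨a, h2, h3⟩ := (h1.and (Ioo_mem_nhdsLT hA)).exists
      exact ⟨a, h3.1, h3.2, h2⟩
    obtain ⟨C, hC⟩ := exists_upperRate_le hμ hX ha haA
    have hlim : Tendsto (fun x : ℝ => (x ^ 2 / (4 * a) + C) / x ^ 2) atTop
        (𝓝 (1 / (4 * a))) := by
      have h4 := (tendsto_const_nhds (x := 1 / (4 * a))).add ((hinv.mul hinv).const_mul C)
      simp only [mul_zero, add_zero] at h4
      refine h4.congr' ?_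
      filter_upwards [eventually_gt_atTop 0] with x hx
      field_simp
    have hlim' := (continuous_coe_real_ereal.tendsto _).comp hlim
    filter_upwards [hlim'.eventually (gt_mem_nhds hay), eventually_ge_atTop 3] with x hx hx3
    refine lt_of_le_of_lt ?_ hx
    simp only [Function.comp, EReal.coe_div]
    exact EReal.div_le_div_right_of_nonneg (EReal.coe_nonneg.2 (sq_nonneg x)) (hC x hx3)

theorem exists_forall_lt_upperRate (hμ : SubGaussianEntries μ A B)
    (hX : ∀ N, IsWigner μ (P N) N (X N)) (a : ℝ) :
    ∃ R : ℝ, ∀ x, R ≤ x → (a : EReal) < upperRate P X x := by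
  have hA : 0 < A := one_pos.trans hμ.one_lt
  have hlt : ((1 / (8 * A) : ℝ) : EReal) < ((1 / (4 * A) : ℝ) : EReal) := by
    rw [EReal.coe_lt_coe_iff]
    exact one_div_lt_one_div_of_lt (by positivity) (by linarith)
  have hsq : Tendsto (fun x : ℝ => 1 / (8 * A) * x ^ 2) atTop atTop :=
    (tendsto_pow_atTop two_ne_zero).const_mul_atTop (by positivity)
  obtain ⟨R, hR⟩ := eventually_atTop.1
    (((tendsto_upperRate_div_sq hμ hX).eventually (lt_mem_nhds hlt)).and
      ((hsq.eventually_gt_atTop a).and (eventually_gt_atTop 0)))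
  refine ⟨R, fun x hx => ?_⟩
  obtain ⟨h1, h2, h3⟩ := hR x hx
  have hx2 : (0 : EReal) < ((x ^ 2 : ℝ) : EReal) := EReal.coe_pos.2 (by positivity)
  rw [EReal.lt_div_iff hx2 (EReal.coe_ne_top _), ← EReal.coe_mul] at h1
  exact (EReal.coe_lt_coe h2).trans h1

theorem isGoodRateFunction_upperRate (hμ : SubGaussianEntries μ A B)
    (hX : ∀ N, IsWigner μ (P N) N (X N)) : IsGoodRateFunction (upperRate P X) where
  nonneg := upperRate_nonneg hμ hX
  lowerSemicontinuous := lowerSemicontinuous_upperRate hμ hX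
  isCompact_sublevel a := by
    obtain ⟨R, hR⟩ := exists_forall_lt_upperRate hμ hX a
    refine isCompact_Icc.of_isClosed_subset (s := Set.Icc 2 R)
      ((lowerSemicontinuous_upperRate hμ hX).isClosed_preimage a) fun x hx => ⟨?_, ?_⟩
    · by_contra hc
      have hx' : upperRate P X x ≤ a := hx
      rw [upperRate, if_pos (not_le.1 hc)] at hx'
      exact absurd hx' (not_le.2 (EReal.coe_lt_top a))
    · by_contra hc
      exact absurd hx (not_le.2 (hR x (not_le.1 hc).le))

end

end WignerLDP

end

theorem proposition1p8 (μ : Measure ℝ) [IsProbabilityMeasure μ] (A B : ℝ)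
    (hμ : WignerLDP.SubGaussianEntries μ A B)
    {Ω : ℕ → Type*} [∀ N, MeasurableSpace (Ω N)]
    (P : ∀ N, Measure (Ω N)) [∀ N, IsProbabilityMeasure (P N)]
    (X : ∀ N, Ω N → Matrix (Fin N) (Fin N) ℝ)
    (hX : ∀ N, WignerLDP.IsWigner μ (P N) N (X N)) :
    LowerSemicontinuous (WignerLDP.upperRate P X) ∧
    Tendsto (fun x : ℝ => WignerLDP.upperRate P X x / ((x ^ 2 : ℝ) : EReal)) atTop
      (𝓝 ((1 / (4 * A) : ℝ) : EReal)) ∧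
    WignerLDP.IsGoodRateFunction (WignerLDP.upperRate P X) :=
  ⟨WignerLDP.lowerSemicontinuous_upperRate hμ hX, WignerLDP.tendsto_upperRate_div_sq hμ hX,
    WignerLDP.isGoodRateFunction_upperRate hμ hX⟩
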